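/- Let $n\ge 2$, $p\ge 0$, $A\in\mathbb R^{n\times p}$, $b\in\mathbb R^n$, $\lambda,\sigma,\rho>0$, $\bar x\in\mathbb R^p$, $\alpha_1\in\mathbb R^n$, $\alpha_2\in\mathbb R^p$. Let $h(u)=\frac{2}{n(n-1)}\sum_{i<j}|u_i-u_j|$. For a convex function $q:\mathbb R^m\to\mathbb R$ put $M_q(x)=\min_y\{q(y)+\frac12\|y-x\|^2\}$ and let $\mathrm{Prox}_q(x)$ be the minimizer. With $f_1(x)=b-Ax+\frac1\rho\alpha_1$ and $f_2(x)=x+\frac1\rho\alpha_2$ define $$\varphi(x)=\rho M_{\frac1\rho h}(f_1(x))+\rho M_{\frac{\lambda}{\rho}\|\cdot\|_1}(f_2(x))+\frac1{2\sigma}\|x-\bar x\|^2,\qquad x\in\mathbb R^p .$$ *Generalized Hessian.* Let $C\in\mathbb R^{(n-1)\times n}$, $(Cx)_i=x_i-x_{i+1}$, $\mathcal D=\{x: Cx\ge 0\}$, $w_k=n-2k+1$. For $y\in\mathbb R^n$ let $P$ be a permutation matrix that sorts $y$ in nonincreasing order, $\tilde y=Py-\frac{2}{\rho n(n-1)}w$,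 and $\Pi_{\mathcal D}(\tilde y)$ the projection of $\tilde y$ onto $\mathcal D$. Let $\mathcal M(y)$ be the set of all matrices $P^\top(I-C_Q^\top(C_QC_Q^\top)^{-1}C_Q)P$, where $Q\subseteq\{i:(C\,\Pi_{\mathcal D}(\tilde y))_i=0\}$ contains the support of a KKT multiplier of the problem $\min_{x\in\mathcal D}\frac12\|x-\tilde y\|^2$, and the matrix $C_Q$ of the rows of $C$ indexed by $Q$ has full row rank. Let $\hat\partial^2\varphi(x)$ be the set of all matrices $\rho(A^\top(I-V_1)A+I-V_2)+\frac1\sigma I$ with $V_1\in\mathcal M(f_1(x))$ and $V_2$ in Clarke's generalized Jacobian of $\mathrm{Prox}_{\frac\lambda\rho\|\cdot\|_1}$ at $f_2(x)$. *Algorithm.* Let $\bar\mu\in(0,\frac12)$, $\delta\in(0,1)$, $\epsilon_{SSN}>0$, $\bar\eta_0>0$, $\bar\eta_1>0$, and let $x^0\in\mathbb R^p$ be arbitrary. For $i=0,1,2,\dots$: (S1) select $\mathcal H_i\in\hat\partial^2\varphi(x^i)$ and apply at least one step of the conjugate gradient method, started at $0$, to $\mathcal H_i d=-\nabla\varphi(x^i)$,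 to obtain an iterate $d^i$ with $\|\mathcal H_id^i+\nabla\varphi(x^i)\|\le\eta_i\|\nabla\varphi(x^i)\|$, where $\eta_i=\min(\bar\eta_0,\bar\eta_1\|\nabla\varphi(x^i)\|)$; (S2) let $m_i$ be the smallest integer $m\ge0$ with $\varphi(x^i+\delta^md^i)\le\varphi(x^i)+\bar\mu\delta^m\nabla\varphi(x^i)^\top d^i$; (S3) put $x^{i+1}=x^i+\delta^{m_i}d^i$; (S4) stop if $\|\nabla\varphi(x^{i+1})\|\le\epsilon_{SSN}$. **Theorem.** The function $\varphi$ is differentiable and $\nabla\varphi(x)=0$ has a unique solution $x^*$. At every point, $\hat\partial^2\varphi$ is nonempty and, for every selected matrix in it, the steps (S1) and (S2) can be carried out. For every starting point and all admissible choices, the sequence $\{x^i\}$ generated by (S1)–(S3) with the stopping test (S4) disregarded converges to $x^*$ quadratically: $x^i\to x^*$, and there is a constant $K$ with $\|x^{i+1}-x^*\|\le K\|x^i-x^*\|^2$ for all sufficiently large $i$. In particular, for every $\epsilon_{SSN}>0$, the test (S4) is met after finitely many iterations. -/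

import Mathlib

open Set Filter Topology Matrix
open scoped InnerProductSpace Gradient

noncomputable section

namespace RankLasso

/-- The Euclidean space `ℝᵐ`. -/
abbrev Vec (m : ℕ) : Type := EuclideanSpace ℝ (Fin m)

/-- The action `v ↦ B v` of a real matrix on Euclidean vectors. -/
abbrev act {m k : ℕ} (B : Matrix (Fin m) (Fin k) ℝ) (v : Vec k) : Vec m :=
  Matrix.toEuclideanLin B v

/-! ### Proximal mappings, Moreau-Yosida regularization, generalized Jacobians -/

/-- A minimizer of `f` over `s` (an arbitrary vector if there is none).  It is only used for
strongly convex `f` and nonempty closed convex `s`, where the minimizer exists and is unique. -/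
def argminOn {m : ℕ} (f : Vec m → ℝ) (s : Set (Vec m)) : Vec m :=
  Classical.epsilon fun x => x ∈ s ∧ IsMinOn f s x

/-- The proximal mapping `Prox_q(x) = argmin_y { q(y) + ½‖y - x‖² }`. -/
def prox {m : ℕ} (q : Vec m → ℝ) (x : Vec m) : Vec m :=
  argminOn (fun y => q y + 1 / 2 * ‖y - x‖ ^ 2) Set.univ

/-- The Moreau-Yosida regularization `M_q(x) = min_y { q(y) + ½‖y - x‖² }`. -/
def moreau {m : ℕ} (q : Vec m → ℝ) (x : Vec m) : ℝ :=
  ⨅ y : Vec m, (q y + 1 / 2 * ‖y - x‖ ^ 2)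

/-- Limits of Jacobians of `F` at points of differentiability converging to `x`. -/
def bouligandJacobian {m k : ℕ} (F : Vec m → Vec k) (x : Vec m) : Set (Vec m →L[ℝ] Vec k) :=
  {V | ∃ z : ℕ → Vec m, (∀ i, DifferentiableAt ℝ F (z i)) ∧ Tendsto z atTop (𝓝 x) ∧
    Tendsto (fun i => fderiv ℝ F (z i)) atTop (𝓝 V)}

/-- Clarke's generalized Jacobian of `F` at `x`, as a set of matrices. -/
def clarkeJacobian {m k : ℕ} (F : Vec m → Vec k) (x : Vec m) : Set (Matrix (Fin k) (Fin m) ℝ) :=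
  {V | LinearMap.toContinuousLinearMap (Matrix.toEuclideanLin V) ∈
    convexHull ℝ (bouligandJacobian F x)}

/-! ### The rank loss, the `L₁` norm and the augmented Lagrangian subproblem -/

/-- The rank loss `h(u) = 2 / (n (n - 1)) * ∑_{i < j} |u_i - u_j|`. -/
def rankLoss {n : ℕ} (u : Vec n) : ℝ :=
  2 / ((n : ℝ) * ((n : ℝ) - 1)) * ∑ i : Fin n, ∑ j ∈ Finset.Ioi i, |u i - u j|

/-- The norm `‖z‖₁`. -/
def l1Norm {p : ℕ} (z : Vec p) : ℝ := ∑ i : Fin p, |z i|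

/-- The data of the inner subproblem: the design matrix `A`, the response `b`, the regularization
parameter `lam`, the proximal parameter `sig = σ_k` with centre `xk = x^k`, the penalty parameter
`rho = ρ_j` and the multipliers `a1 = α₁^j`, `a2 = α₂^j`. -/
structure Subproblem (n p : ℕ) where
  A : Matrix (Fin n) (Fin p) ℝ
  b : Vec n
  lam : ℝ
  sig : ℝ
  xk : Vec p
  rho : ℝ
  a1 : Vec n
  a2 : Vec p

namespace Subproblem

variable {n p : ℕ} (S : Subproblem n p)

/-- `f₁(x) = b - A x + α₁ / ρ`. -/
def f1 (x : Vec p) : Vec n := S.b - act S.A x + (1 / S.rho) • S.a1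

/-- `f₂(x) = x + α₂ / ρ`. -/
def f2 (x : Vec p) : Vec p := x + (1 / S.rho) • S.a2

/-- `h / ρ`. -/
def scaledLoss (u : Vec n) : ℝ := 1 / S.rho * rankLoss u

/-- `(λ / ρ) ‖·‖₁`. -/
def scaledL1 (z : Vec p) : ℝ := S.lam / S.rho * l1Norm z

/-- The objective
`φ(x) = ρ M_{h/ρ}(f₁(x)) + ρ M_{(λ/ρ)‖·‖₁}(f₂(x)) + (1 / (2σ)) ‖x - x^k‖²`. -/
def phi (x : Vec p) : ℝ :=
  S.rho * moreau S.scaledLoss (S.f1 x) + S.rho * moreau S.scaledL1 (S.f2 x)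
    + 1 / (2 * S.sig) * ‖x - S.xk‖ ^ 2

end Subproblem

/-! ### The generalized Jacobian `𝓜` of the proximal mapping of the rank loss -/

/-- The `(n-1) × n` matrix `C` with `C x = (x₁ - x₂, …, x_{n-1} - x_n)`. -/
def diffMatrix (n : ℕ) : Matrix (Fin (n - 1)) (Fin n) ℝ :=
  fun i j => if j.val = i.val then 1 else if j.val = i.val + 1 then -1 else 0

/-- The cone `𝒟 = {x | C x ≥ 0}`. -/
def monoCone (n : ℕ) : Set (Vec n) := {x | ∀ i, 0 ≤ (act (diffMatrix n) x) i}

/-- The Euclidean projection onto `𝒟`. -/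
def projCone {n : ℕ} (z : Vec n) : Vec n :=
  argminOn (fun x => 1 / 2 * ‖x - z‖ ^ 2) (monoCone n)

/-- The vector `w_k = n - 2k + 1`, `k = 1, …, n` (here with `k = i + 1`). -/
def weight (n : ℕ) : Vec n :=
  WithLp.toLp 2 fun i : Fin n => (n : ℝ) - 2 * ((i.val : ℝ) + 1) + 1

/-- `P_y` sorts `y` in nonincreasing order; its matrix acts by `(P y)_i = y (P i)`. -/
def Sorts {n : ℕ} (P : Equiv.Perm (Fin n)) (y : Vec n) : Prop := Antitone fun i => y (P i)

/-- `ỹ = P y - (2τ / (n (n - 1))) w`. -/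
def shifted {n : ℕ} (tau : ℝ) (P : Equiv.Perm (Fin n)) (y : Vec n) : Vec n :=
  act (P.permMatrix ℝ) y - (2 * tau / ((n : ℝ) * ((n : ℝ) - 1))) • weight n

/-- The active index set `{i | C_i Π_𝒟(z) = 0}`. -/
def activeSet {n : ℕ} (z : Vec n) : Set (Fin (n - 1)) :=
  {i | (act (diffMatrix n) (projCone z)) i = 0}

/-- The multipliers `l` that satisfy, together with the solution `Π_𝒟(z)`, the KKT conditions of
`min { ½‖x - z‖² | C x ≥ 0 }`. -/
def multipliers {n : ℕ} (z : Vec n) : Set (Vec (n - 1)) :=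
  {l | projCone z - z - act (diffMatrix n)ᵀ l = 0 ∧ projCone z ∈ monoCone n ∧
    (∀ i, 0 ≤ l i) ∧ ∀ i, l i * (act (diffMatrix n) (projCone z)) i = 0}

/-- The rows `C_Q` of `C` indexed by `Q`. -/
def rowsOf {n : ℕ} (Q : Finset (Fin (n - 1))) : Matrix Q (Fin n) ℝ :=
  (diffMatrix n).submatrix Subtype.val id

/-- The collection of index sets `Q` with `supp l ⊆ Q ⊆ activeSet z` for some multiplier `l`, and
`C_Q` of full row rank. -/
def indexSets {n : ℕ} (z : Vec n) : Set (Finset (Fin (n - 1))) :=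
  {Q | (∃ l ∈ multipliers z, ∀ i, l i ≠ 0 → i ∈ Q) ∧ (∀ i ∈ Q, i ∈ activeSet z) ∧
    LinearIndependent ℝ (rowsOf Q).row}

/-- `𝓜(y)` for the proximal mapping of `τ h`: all matrices
`P_yᵀ (I - C_Qᵀ (C_Q C_Qᵀ)⁻¹ C_Q) P_y` with `P_y` a permutation matrix sorting `y`. -/
def rankJacobian {n : ℕ} (tau : ℝ) (y : Vec n) : Set (Matrix (Fin n) (Fin n) ℝ) :=
  {U | ∃ P : Equiv.Perm (Fin n), Sorts P y ∧ ∃ Q ∈ indexSets (shifted tau P y),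
    U = (P.permMatrix ℝ)ᵀ *
      (1 - (rowsOf Q)ᵀ * (rowsOf Q * (rowsOf Q)ᵀ)⁻¹ * rowsOf Q) * P.permMatrix ℝ}

/-- The generalized Hessian of `φ` at `x`: all matrices
`ρ (Aᵀ (I - V₁) A + I - V₂) + σ⁻¹ I` with `V₁ ∈ 𝓜(f₁(x))` and
`V₂ ∈ ∂ Prox_{(λ/ρ)‖·‖₁}(f₂(x))`. -/
def Subproblem.genHessian {n p : ℕ} (S : Subproblem n p) (x : Vec p) :
    Set (Matrix (Fin p) (Fin p) ℝ) :=
  {H | ∃ V₁ ∈ rankJacobian (1 / S.rho) (S.f1 x),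
    ∃ V₂ ∈ clarkeJacobian (prox S.scaledL1) (S.f2 x),
      H = S.rho • (S.Aᵀ * (1 - V₁) * S.A + 1 - V₂)
        + (1 / S.sig) • (1 : Matrix (Fin p) (Fin p) ℝ)}

/-! ### The conjugate gradient method -/

/-- The state of the conjugate gradient method: iterate, residual, search direction. -/
structure CGState (p : ℕ) where
  d : Vec p
  r : Vec p
  s : Vec p

/-- One conjugate gradient step for the matrix `H`.  After the residual has become zero the state
does not change any more (`0 / 0 = 0`). -/
def cgStep {p : ℕ} (H : Matrix (Fin p) (Fin p) ℝ) (t : CGState p) : CGState p :=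
  let a : ℝ := ⟪t.r, t.r⟫_ℝ / ⟪t.s, act H t.s⟫_ℝ
  let r' : Vec p := t.r - a • act H t.s
  let β : ℝ := ⟪r', r'⟫_ℝ / ⟪t.r, t.r⟫_ℝ
  { d := t.d + a • t.s, r := r', s := r' + β • t.s }

/-- The `k`-th conjugate gradient iterate for `H d = c`, started at `d = 0`. -/
def cgIterate {p : ℕ} (H : Matrix (Fin p) (Fin p) ℝ) (c : Vec p) (k : ℕ) : Vec p :=
  ((cgStep H)^[k] { d := 0, r := c, s := c }).d

/-! ### The globalized semismooth Newton method -/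

/-- The parameters `μ̄`, `δ`, `η̄₀`, `η̄₁` of the method. -/
structure SSNParams where
  mu : ℝ
  del : ℝ
  eta0 : ℝ
  eta1 : ℝ

/-- The admissible ranges of the parameters. -/
structure SSNParams.Valid (N : SSNParams) : Prop where
  mu_pos : 0 < N.mu
  mu_lt : N.mu < 1 / 2
  del_pos : 0 < N.del
  del_lt : N.del < 1
  eta0_pos : 0 < N.eta0
  eta1_pos : 0 < N.eta1

section Method

variable {n p : ℕ} (S : Subproblem n p) (N : SSNParams)

/-- Step S1: `d` is obtained by at least one conjugate gradient step for `H d = -∇φ(x)` and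
`‖H d + ∇φ(x)‖ ≤ η ‖∇φ(x)‖` with `η = min(η̄₀, η̄₁‖∇φ(x)‖)`. -/
def IsNewtonDirection (x : Vec p) (H : Matrix (Fin p) (Fin p) ℝ) (d : Vec p) : Prop :=
  (∃ k : ℕ, 1 ≤ k ∧ d = cgIterate H (-∇ S.phi x) k) ∧
    ‖act H d + ∇ S.phi x‖ ≤ min N.eta0 (N.eta1 * ‖∇ S.phi x‖) * ‖∇ S.phi x‖

/-- The line search condition
`φ(x + δᵐ d) ≤ φ(x) + μ̄ δᵐ ⟨∇φ(x), d⟩`. -/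
def Armijo (x d : Vec p) (m : ℕ) : Prop :=
  S.phi (x + N.del ^ m • d) ≤ S.phi x + N.mu * N.del ^ m * ⟪∇ S.phi x, d⟫_ℝ

/-- Steps S1, S2, S3: one iteration of the method leads from `x` to `x'`. -/
def SSNStep (x x' : Vec p) : Prop :=
  ∃ H ∈ S.genHessian x, ∃ d : Vec p, IsNewtonDirection S N x H d ∧
    ∃ m : ℕ, IsLeast {m | Armijo S N x d m} m ∧ x' = x + N.del ^ m • d

/-- `x⁰, x¹, x², …` is generated by the method, the stopping test being switched off. -/
def IsSSNSequence (x : ℕ → Vec p) : Prop := ∀ i, SSNStep S N (x i) (x (i + 1))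

end Method

/-- Quadratic convergence of `x` to `xs`. -/
def ConvergesQuadratically {p : ℕ} (x : ℕ → Vec p) (xs : Vec p) : Prop :=
  Tendsto x atTop (𝓝 xs) ∧
    ∃ K : ℝ, ∀ᶠ i in atTop, ‖x (i + 1) - xs‖ ≤ K * ‖x i - xs‖ ^ 2

end RankLasso

end

namespace RankLasso

/-! ### Matrices acting on Euclidean vectors -/

lemma act_mul {m k l : ℕ} (B : Matrix (Fin m) (Fin k) ℝ) (C : Matrix (Fin k) (Fin l) ℝ)
    (v : Vec l) : act (B * C) v = act B (act C v) := by
  ext i; simp [Matrix.toLpLin_apply, Matrix.mulVec_mulVec]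

lemma act_one {m : ℕ} (v : Vec m) : act (1 : Matrix (Fin m) (Fin m) ℝ) v = v := by
  ext i; simp [Matrix.toLpLin_apply]

lemma act_sub_left {m k : ℕ} (B C : Matrix (Fin m) (Fin k) ℝ) (v : Vec k) :
    act (B - C) v = act B v - act C v := by
  simp [act]

lemma act_add_left {m k : ℕ} (B C : Matrix (Fin m) (Fin k) ℝ) (v : Vec k) :
    act (B + C) v = act B v + act C v := by
  simp [act]

lemma act_smul_left {m k : ℕ} (c : ℝ) (B : Matrix (Fin m) (Fin k) ℝ) (v : Vec k) :
    act (c • B) v = c • act B v := by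
  simp [act]

lemma act_add {m k : ℕ} (B : Matrix (Fin m) (Fin k) ℝ) (u v : Vec k) :
    act B (u + v) = act B u + act B v := map_add _ _ _

lemma act_sub {m k : ℕ} (B : Matrix (Fin m) (Fin k) ℝ) (u v : Vec k) :
    act B (u - v) = act B u - act B v := map_sub _ _ _

lemma act_smul {m k : ℕ} (B : Matrix (Fin m) (Fin k) ℝ) (c : ℝ) (v : Vec k) :
    act B (c • v) = c • act B v := map_smul _ _ _

lemma inner_act_transpose {m k : ℕ} (B : Matrix (Fin m) (Fin k) ℝ) (u : Vec m) (v : Vec k) :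
    ⟪act Bᵀ u, v⟫_ℝ = ⟪u, act B v⟫_ℝ := by
  simp only [EuclideanSpace.inner_eq_star_dotProduct, Matrix.toLpLin_apply, star_trivial]
  rw [Matrix.mulVec_transpose, dotProduct_comm, ← Matrix.dotProduct_mulVec, dotProduct_comm]

lemma exists_norm_act_le {m k : ℕ} (B : Matrix (Fin m) (Fin k) ℝ) :
    ∃ a, 0 ≤ a ∧ ∀ v, ‖act B v‖ ≤ a * ‖v‖ :=
  ⟨_, norm_nonneg _, (LinearMap.toContinuousLinearMap (Matrix.toEuclideanLin B)).le_opNorm⟩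

lemma continuous_act {m k : ℕ} (B : Matrix (Fin m) (Fin k) ℝ) : Continuous (act B) :=
  LinearMap.continuous_of_finiteDimensional _

/-! ### Proximal points -/

/-- `p` satisfies the optimality condition `x - p ∈ ∂q(p)` of `Prox_q(x)`. -/
def IsProxPoint {m : ℕ} (q : Vec m → ℝ) (x p : Vec m) : Prop :=
  ∀ u, q p + ⟪x - p, u - p⟫_ℝ ≤ q u

section Prox

variable {m : ℕ} {q : Vec m → ℝ} {x p : Vec m}

lemma norm_sub_sq_expand (u p x : Vec m) :
    ‖u - x‖ ^ 2 = ‖u - p‖ ^ 2 - 2 * ⟪x - p, u - p⟫_ℝ + ‖p - x‖ ^ 2 := by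
  have : u - x = (u - p) - (x - p) := by abel
  rw [this, norm_sub_sq_real, norm_sub_rev p x, real_inner_comm]

lemma isProxPoint_of_isMin (hq : ConvexOn ℝ univ q)
    (hp : ∀ y, q p + 1 / 2 * ‖p - x‖ ^ 2 ≤ q y + 1 / 2 * ‖y - x‖ ^ 2) : IsProxPoint q x p := by
  intro u
  by_contra! hlt
  set a := q p + ⟪x - p, u - p⟫_ℝ - q u with ha
  have hapos : 0 < a := by linarith
  set B := ‖u - p‖ ^ 2 with hB
  have hB0 : 0 ≤ B := sq_nonneg _
  -- Moving from `p` towards `u` gains `t a` to first order and loses `t² B / 2`; this `t` gives `t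
  -- B < a`, so the gain wins.
  set t := min 1 (a / (B + 1)) with ht
  have ht0 : 0 < t := by positivity
  have ht1 : t ≤ 1 := min_le_left _ _
  have htB : t * B < a := by
    have h1 : t * (B + 1) ≤ a := by
      rw [← le_div_iff₀ (by positivity)]; exact min_le_right _ _
    nlinarith
  have h1 := hp ((1 - t) • p + t • u)
  have h2 := hq.2 (mem_univ p) (mem_univ u) (sub_nonneg.2 ht1) ht0.le (by ring)
  have h3 := norm_sub_sq_expand ((1 - t) • p + t • u) p x
  have h4 : (1 - t) • p + t • u - p = t • (u - p) := by module
  rw [h4, norm_smul, inner_smul_right, mul_pow, Real.norm_eq_abs, sq_abs, ← hB] at h3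
  simp only [smul_eq_mul] at h2
  have h5 : 0 ≤ t * (t * B / 2 - a) := by nlinarith
  have := nonneg_of_mul_nonneg_right h5 ht0
  nlinarith

lemma IsProxPoint.add_le (h : IsProxPoint q x p) (u : Vec m) :
    q p + 1 / 2 * ‖p - x‖ ^ 2 + 1 / 2 * ‖u - p‖ ^ 2 ≤ q u + 1 / 2 * ‖u - x‖ ^ 2 := by
  have := norm_sub_sq_expand u p x
  have := h u
  linarith

lemma IsProxPoint.prox_eq (h : IsProxPoint q x p) : prox q x = p := by
  have hmin : ∃ y, y ∈ univ ∧ IsMinOn (fun y => q y + 1 / 2 * ‖y - x‖ ^ 2) univ y :=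
    ⟨p, mem_univ _, fun u _ => by
      have := h.add_le u
      have h2 := sq_nonneg ‖u - p‖
      simp only [mem_ofPred_eq]; linarith⟩
  have h1 := (Classical.epsilon_spec hmin).2 (mem_univ p)
  change q (prox q x) + 1 / 2 * ‖prox q x - x‖ ^ 2 ≤ q p + 1 / 2 * ‖p - x‖ ^ 2 at h1
  have h2 := h.add_le (prox q x)
  have h3 : ‖prox q x - p‖ ^ 2 ≤ 0 := by linarith
  have h4 : ‖prox q x - p‖ = 0 := by nlinarith [norm_nonneg (prox q x - p)]
  exact sub_eq_zero.1 (norm_eq_zero.1 h4)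

lemma IsProxPoint.moreau_eq (h : IsProxPoint q x p) :
    moreau q x = q p + 1 / 2 * ‖p - x‖ ^ 2 := by
  have hle : ∀ u, q p + 1 / 2 * ‖p - x‖ ^ 2 ≤ q u + 1 / 2 * ‖u - x‖ ^ 2 := fun u => by
    have := h.add_le u
    have h2 := sq_nonneg ‖u - p‖
    linarith
  exact le_antisymm (ciInf_le ⟨_, forall_mem_range.2 hle⟩ p) (le_ciInf hle)

/-- The Moreau-Yosida regularization lies above its linearization with slope `x - Prox_q(x)`. -/
lemma moreau_lower (h : ∀ x, IsProxPoint q x (prox q x)) (x x' : Vec m) :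
    moreau q x + ⟪x - prox q x, x' - x⟫_ℝ ≤ moreau q x' := by
  rw [(h x).moreau_eq, (h x').moreau_eq]
  set p := prox q x
  set p' := prox q x'
  have h1 := h x p'
  have h2 : p' - p = (x' - x) + (x - p) - (x' - p') := by abel
  rw [h2, inner_sub_right, inner_add_right, real_inner_self_eq_norm_sq] at h1
  have h3 := norm_sub_sq_real (x - p) (x' - p')
  -- This square is the slack left after the subgradient inequality at `p` is tested with `p'`.
  have h4 := sq_nonneg ‖(x - p) - (x' - p')‖
  rw [norm_sub_rev p x, norm_sub_rev p' x']
  linarith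

/-- The old proximal point `prox q x` is a competitor in the minimization that defines the envelope
at `x'`. -/
lemma moreau_upper (h : ∀ x, IsProxPoint q x (prox q x)) (x x' : Vec m) :
    moreau q x' ≤ moreau q x + ⟪x - prox q x, x' - x⟫_ℝ + 1 / 2 * ‖x' - x‖ ^ 2 := by
  rw [(h x).moreau_eq]
  have h1 := (h x').moreau_eq ▸ (h x').add_le (prox q x)
  have h2 := norm_sub_sq_expand (prox q x) x x'
  have h3 : ⟪x' - x, prox q x - x⟫_ℝ = -⟪x - prox q x, x' - x⟫_ℝ := by
    rw [real_inner_comm, ← inner_neg_left, neg_sub]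
  have h4 := sq_nonneg ‖prox q x - prox q x'‖
  have h5 := norm_sub_rev x x'
  rw [h3, h5] at h2
  linarith

end Prox

/-- Two-sided quadratic bounds identify the gradient. -/
lemma hasGradientAt_of_bounds {m : ℕ} {f : Vec m → ℝ} {g x : Vec m} {K : ℝ}
    (h1 : ∀ x', f x + ⟪g, x' - x⟫_ℝ ≤ f x')
    (h2 : ∀ x', f x' ≤ f x + ⟪g, x' - x⟫_ℝ + K * ‖x' - x‖ ^ 2) : HasGradientAt f g x := by
  rw [hasGradientAt_iff_isLittleO]
  refine Asymptotics.IsBigO.trans_isLittleO (g := fun x' => ‖x' - x‖ ^ 2) ?_ ?_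
  · refine Asymptotics.IsBigO.of_bound K (Eventually.of_forall fun x' => ?_)
    have := h1 x'
    have := h2 x'
    rw [Real.norm_eq_abs, abs_of_nonneg (by linarith), Real.norm_eq_abs,
      abs_of_nonneg (sq_nonneg _)]
    linarith
  · exact Asymptotics.isLittleO_pow_sub_sub x one_lt_two

/-! ### The conjugate gradient method -/

section CG

variable {p : ℕ} {H : Matrix (Fin p) (Fin p) ℝ} {m L : ℝ}

/-- Symmetry of `H` and the bounds `m ≤ H ≤ L`. -/
structure SymmBounds (H : Matrix (Fin p) (Fin p) ℝ) (m L : ℝ) : Prop where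
  symm : ∀ u v : Vec p, ⟪act H u, v⟫_ℝ = ⟪u, act H v⟫_ℝ
  lower : ∀ v : Vec p, m * ‖v‖ ^ 2 ≤ ⟪v, act H v⟫_ℝ
  upper : ∀ v : Vec p, ⟪v, act H v⟫_ℝ ≤ L * ‖v‖ ^ 2

/-- The invariants of the conjugate gradient method for `H d = c`. -/
structure CGInv (H : Matrix (Fin p) (Fin p) ℝ) (c : Vec p) (t : CGState p) : Prop where
  res : t.r = c - act H t.d
  dir : ⟪t.s, t.r⟫_ℝ = ⟪t.r, t.r⟫_ℝ
  conj : ⟪act H t.s, t.r⟫_ℝ = ⟪act H t.s, t.s⟫_ℝ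

lemma SymmBounds.inner_pos (h : SymmBounds H m L) (hm : 0 < m) {v : Vec p} (hv : v ≠ 0) :
    0 < ⟪v, act H v⟫_ℝ :=
  lt_of_lt_of_le (by have := norm_pos_iff.2 hv; positivity) (h.lower v)

/-- With zero residual, `conj` gives `⟨s, H s⟩ = 0`, so the search direction vanishes as well. -/
lemma cgStep_of_res_eq_zero {c : Vec p} {t : CGState p} (h : CGInv H c t) (hH : SymmBounds H m L)
    (hm : 0 < m) (hr : t.r = 0) : cgStep H t = t := by
  have hs : t.s = 0 := by
    by_contra hs
    have h1 := hH.inner_pos hm hs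
    have h2 := h.conj
    rw [hr, inner_zero_right, hH.symm] at h2
    linarith
  obtain ⟨d, r, s⟩ := t
  simp only at hr hs
  simp [cgStep, hr, hs]

/-- Full mutual conjugacy of the directions is not needed: orthogonality of the new residual to `r`
and `s` makes the new direction conjugate to `s`, which yields `conj`. -/
lemma CGInv.step {c : Vec p} {t : CGState p} (h : CGInv H c t) (hH : SymmBounds H m L)
    (hm : 0 < m) : CGInv H c (cgStep H t) := by
  by_cases hr : t.r = 0
  · rwa [cgStep_of_res_eq_zero h hH hm hr]
  have hrr : 0 < ⟪t.r, t.r⟫_ℝ := real_inner_self_pos.2 hr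
  have hs : t.s ≠ 0 := by
    rintro hs
    have := h.dir
    rw [hs, inner_zero_left] at this
    linarith
  have hsH := hH.inner_pos hm hs
  obtain ⟨d, r, s⟩ := t
  obtain ⟨h1, h2, h3⟩ := h
  simp only at h1 h2 h3 hrr hsH
  rw [hH.symm s s] at h3
  set a : ℝ := ⟪r, r⟫_ℝ / ⟪s, act H s⟫_ℝ with ha
  have haH : a * ⟪s, act H s⟫_ℝ = ⟪r, r⟫_ℝ := div_mul_cancel₀ _ hsH.ne'
  have hapos : 0 < a := div_pos hrr hsH
  set r' : Vec p := r - a • act H s with hr'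
  set β : ℝ := ⟪r', r'⟫_ℝ / ⟪r, r⟫_ℝ with hβ
  have hβr : β * ⟪r, r⟫_ℝ = ⟪r', r'⟫_ℝ := div_mul_cancel₀ _ hrr.ne'
  have hsr' : ⟪s, r'⟫_ℝ = 0 := by
    rw [hr', inner_sub_right, inner_smul_right, h2, haH, sub_self]
  have hrr' : ⟪r, r'⟫_ℝ = 0 := by
    rw [hr', inner_sub_right, inner_smul_right, real_inner_comm (act H s) r, h3, haH, sub_self]
  have hHs : a * ⟪act H s, r'⟫_ℝ = -⟪r', r'⟫_ℝ := by
    have : a • act H s = r - r' := by rw [hr']; abel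
    rw [← real_inner_smul_left, this, inner_sub_left, hrr', zero_sub]
  have hconj : ⟪act H (r' + β • s), s⟫_ℝ = 0 := by
    rw [act_add, act_smul, inner_add_left, real_inner_smul_left, hH.symm s s, hH.symm r' s,
      real_inner_comm]
    have : a * (⟪act H s, r'⟫_ℝ + β * ⟪s, act H s⟫_ℝ) = 0 := by
      linear_combination hHs + β * haH + hβr
    simpa using (mul_eq_zero.1 this).resolve_left hapos.ne'
  refine ⟨?_, ?_, ?_⟩
  · change r' = c - act H (d + a • s)
    rw [hr', h1, act_add, act_smul]; abel
  · change ⟪r' + β • s, r'⟫_ℝ = ⟪r', r'⟫_ℝ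
    rw [inner_add_left, real_inner_smul_left, hsr']; simp
  · change ⟪act H (r' + β • s), r'⟫_ℝ = ⟪act H (r' + β • s), r' + β • s⟫_ℝ
    rw [inner_add_right _ r', inner_smul_right, hconj]; simp

/-- The quadratic `½⟨d, H d⟩ - ⟨c, d⟩` minimized by the conjugate gradient method. -/
noncomputable def quadModel {p : ℕ} (H : Matrix (Fin p) (Fin p) ℝ) (c d : Vec p) : ℝ :=
  1 / 2 * ⟪d, act H d⟫_ℝ - ⟪c, d⟫_ℝ

/-- The step is an exact line search and gains `(a/2)‖r‖²`. It remains to see `a ≥ 1/L`. -/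
lemma CGInv.quadModel_step_le {c : Vec p} {t : CGState p} (h : CGInv H c t)
    (hH : SymmBounds H m L) (hm : 0 < m) (hL : 0 < L) :
    quadModel H c (cgStep H t).d ≤ quadModel H c t.d - ‖t.r‖ ^ 2 / (2 * L) := by
  by_cases hr : t.r = 0
  · rw [cgStep_of_res_eq_zero h hH hm hr, hr]; simp
  have hrr : 0 < ⟪t.r, t.r⟫_ℝ := real_inner_self_pos.2 hr
  have hs : t.s ≠ 0 := by
    rintro hs
    have := h.dir
    rw [hs, inner_zero_left] at this
    linarith
  have hsH := hH.inner_pos hm hs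
  -- By `conj`, `s - r` is `H`-orthogonal to `s`, so Pythagoras in the `H`-norm gives `⟨s, H s⟩ ≤
  -- ⟨r, H r⟩`.
  have hle : ⟪t.s, act H t.s⟫_ℝ ≤ L * ⟪t.r, t.r⟫_ℝ := by
    have h0 : 0 ≤ ⟪t.s - t.r, act H (t.s - t.r)⟫_ℝ :=
      (by positivity : (0 : ℝ) ≤ m * ‖t.s - t.r‖ ^ 2).trans (hH.lower _)
    rw [act_sub, inner_sub_left, inner_sub_right, inner_sub_right, ← hH.symm t.s t.r,
      ← hH.symm t.s t.s, h.conj, real_inner_comm (act H t.s) t.r, h.conj] at h0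
    have h1 := hH.upper t.r
    rw [real_inner_self_eq_norm_sq, ← hH.symm t.s t.s]
    linarith
  obtain ⟨d, r, s⟩ := t
  obtain ⟨h1, h2, h3⟩ := h
  simp only at h1 h2 h3 hrr hsH hle ⊢
  set a : ℝ := ⟪r, r⟫_ℝ / ⟪s, act H s⟫_ℝ with ha
  have haH : a * ⟪s, act H s⟫_ℝ = ⟪r, r⟫_ℝ := div_mul_cancel₀ _ hsH.ne'
  change quadModel H c (d + a • s) ≤ _
  have hc : ⟪c, s⟫_ℝ = ⟪r, r⟫_ℝ + ⟪d, act H s⟫_ℝ := by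
    rw [← h2, h1, inner_sub_right, real_inner_comm c s, real_inner_comm (act H d) s, hH.symm]
    ring
  have key : quadModel H c (d + a • s) = quadModel H c d - a / 2 * ⟪r, r⟫_ℝ := by
    have hsd : ⟪s, act H d⟫_ℝ = ⟪d, act H s⟫_ℝ := by rw [← hH.symm, real_inner_comm]
    simp only [quadModel, act_add, act_smul, inner_add_left, inner_add_right, inner_smul_right,
      real_inner_smul_left, hc, hsd]
    linear_combination (a / 2) * haH
  have ha' : 1 / L ≤ a := by
    rw [ha, div_le_div_iff₀ hL hsH]; linarith
  rw [key, ← real_inner_self_eq_norm_sq]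
  have : ⟪r, r⟫_ℝ / (2 * L) = 1 / L / 2 * ⟪r, r⟫_ℝ := by field_simp
  rw [this]
  gcongr

lemma cgInv_iterate {c : Vec p} (hH : SymmBounds H m L) (hm : 0 < m) (k : ℕ) :
    CGInv H c ((cgStep H)^[k] { d := 0, r := c, s := c }) := by
  induction k with
  | zero => exact ⟨by simp, rfl, rfl⟩
  | succ k ih => rw [Function.iterate_succ_apply']; exact ih.step hH hm

lemma quadModel_cgIterate_succ_le {c : Vec p} (hH : SymmBounds H m L) (hm : 0 < m) (hL : 0 < L)
    (k : ℕ) : quadModel H c (cgIterate H c (k + 1)) ≤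
      quadModel H c (cgIterate H c k) - ‖c - act H (cgIterate H c k)‖ ^ 2 / (2 * L) := by
  have h := cgInv_iterate (c := c) hH hm k
  have h1 := h.quadModel_step_le hH hm hL
  rw [← Function.iterate_succ_apply' (cgStep H) k, h.res] at h1
  exact h1

lemma quadModel_cgIterate_le {c : Vec p} (hH : SymmBounds H m L) (hm : 0 < m) (hL : 0 < L)
    {k : ℕ} (hk : 1 ≤ k) : quadModel H c (cgIterate H c k) ≤ -(‖c‖ ^ 2 / (2 * L)) := by
  induction k, hk using Nat.le_induction with
  | base =>
    have := quadModel_cgIterate_succ_le (c := c) hH hm hL 0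
    simpa [cgIterate, quadModel] using this
  | succ k _ ih =>
    refine (quadModel_cgIterate_succ_le hH hm hL k).trans (le_trans ?_ ih)
    have : 0 ≤ ‖c - act H (cgIterate H c k)‖ ^ 2 / (2 * L) := by positivity
    linarith

/-- Conjugate gradient iterates make an acute angle with the right-hand side. -/
lemma inner_cgIterate_ge {c : Vec p} (hH : SymmBounds H m L) (hm : 0 < m) (hL : 0 < L)
    {k : ℕ} (hk : 1 ≤ k) :
    ‖c‖ ^ 2 / (2 * L) + m / 2 * ‖cgIterate H c k‖ ^ 2 ≤ ⟪c, cgIterate H c k⟫_ℝ := by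
  have h1 := quadModel_cgIterate_le (c := c) hH hm hL hk
  have h2 := hH.lower (cgIterate H c k)
  unfold quadModel at h1
  linarith

lemma quadModel_ge {c : Vec p} (hH : SymmBounds H m L) (hm : 0 < m) (d : Vec p) :
    -(‖c‖ ^ 2 / (2 * m)) ≤ quadModel H c d := by
  have h1 := hH.lower d
  have h2 := real_inner_le_norm c d
  have h3 : 0 ≤ (‖c‖ - m * ‖d‖) ^ 2 / (2 * m) := by positivity
  have h4 : (‖c‖ - m * ‖d‖) ^ 2 / (2 * m)
      = ‖c‖ ^ 2 / (2 * m) - ‖c‖ * ‖d‖ + m / 2 * ‖d‖ ^ 2 := by field_simp; ring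
  unfold quadModel
  linarith

/-- The residuals of the conjugate gradient method become arbitrarily small. -/
lemma exists_cgIterate_residual_le {c : Vec p} (hH : SymmBounds H m L) (hm : 0 < m) (hL : 0 < L)
    {ε : ℝ} (hε : 0 < ε) : ∃ k, 1 ≤ k ∧ ‖act H (cgIterate H c k) - c‖ ≤ ε := by
  by_contra! hcon
  -- Residuals that stay above `ε` lower the model by a fixed amount per step, although it is
  -- bounded below.
  have hdec : ∀ k : ℕ, quadModel H c (cgIterate H c (k + 1)) ≤
      quadModel H c (cgIterate H c 1) - k * (ε ^ 2 / (2 * L)) := by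
    intro k
    induction k with
    | zero => simp
    | succ k ih =>
      have h1 := quadModel_cgIterate_succ_le (c := c) hH hm hL (k + 1)
      have h2 := hcon (k + 1) (by omega)
      rw [norm_sub_rev] at h2
      have h3 : ε ^ 2 / (2 * L) ≤ ‖c - act H (cgIterate H c (k + 1))‖ ^ 2 / (2 * L) := by
        gcongr
      push_cast
      linarith
  obtain ⟨k, hk⟩ := Archimedean.arch
    (quadModel H c (cgIterate H c 1) + ‖c‖ ^ 2 / (2 * m) + 1)
    (by positivity : 0 < ε ^ 2 / (2 * L))
  have h1 := hdec k
  have h2 := quadModel_ge (c := c) hH hm (cgIterate H c (k + 1))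
  rw [nsmul_eq_mul] at hk
  linarith

end CG

/-! ### The difference matrix and the monotone cone -/

section Cone

variable {n : ℕ}

lemma act_diffMatrix_apply (x : Vec n) (i : Fin (n - 1)) :
    act (diffMatrix n) x i = x ⟨i, by omega⟩ - x ⟨i + 1, by omega⟩ := by
  have h : ∀ j : Fin n, diffMatrix n i j * x j =
      (if j = ⟨i, by omega⟩ then x j else 0) - (if j = ⟨i + 1, by omega⟩ then x j else 0) := by
    intro j
    simp only [diffMatrix, Fin.ext_iff]
    split_ifs <;> first | omega | simp
  change ∑ j, diffMatrix n i j * x j = _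
  simp [h, Finset.sum_sub_distrib]

lemma mem_monoCone_iff {x : Vec n} : x ∈ monoCone n ↔ Antitone x := by
  simp only [monoCone, mem_ofPred_eq, act_diffMatrix_apply, sub_nonneg]
  refine ⟨fun h => ?_, fun h i => h (by simp [Fin.le_def])⟩
  cases n with
  | zero => exact fun i => i.elim0
  | succ k => exact Fin.antitone_iff_succ_le.2 fun i => h i

/-- Extending `l`, shifted by one, by zeros at `0` and `n` turns `Cᵀ l` into a plain difference
sequence, with no special first and last entries. -/
lemma act_diffMatrix_transpose_apply {L : ℕ → ℝ} (h0 : L 0 = 0) (hn : L n = 0) {l : Vec (n - 1)}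
    (hl : ∀ i, l i = L (i + 1)) (j : Fin n) :
    act (diffMatrix n)ᵀ l j = L (j + 1) - L j := by
  have h : ∀ i : Fin (n - 1), (diffMatrix n)ᵀ j i * l i =
      (fun k : ℕ => (if (j : ℕ) = k then L (k + 1) else 0)
        - (if (j : ℕ) = k + 1 then L (k + 1) else 0)) i := by
    intro i
    simp only [diffMatrix, Matrix.transpose_apply, hl]
    split_ifs <;> first | omega | simp
  change ∑ i, (diffMatrix n)ᵀ j i * l i = _
  rw [Finset.sum_congr rfl fun i _ => h i, Fin.sum_univ_eq_sum_range (fun k : ℕ =>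
    (if (j : ℕ) = k then L (k + 1) else 0) - (if (j : ℕ) = k + 1 then L (k + 1) else 0)),
    Finset.sum_sub_distrib, Finset.sum_ite_eq]
  have hj := j.2
  congr 1
  · split_ifs with h1
    · rfl
    · rw [Finset.mem_range] at h1
      rw [show (j : ℕ) + 1 = n by omega, hn]
  · rcases hk : (j : ℕ) with _ | k
    · simp [h0]
    · simp only [Nat.add_right_cancel_iff]
      rw [Finset.sum_ite_eq, if_pos (Finset.mem_range.2 (by omega))]

lemma act_diffMatrix_transpose_injective : Function.Injective (act (diffMatrix n)ᵀ) := by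
  refine (injective_iff_map_eq_zero (Matrix.toEuclideanLin (diffMatrix n)ᵀ)).2 fun l hl => ?_
  set L : ℕ → ℝ := fun k => if h : 1 ≤ k ∧ k - 1 < n - 1 then l ⟨k - 1, h.2⟩ else 0 with hL
  have h0 : L 0 = 0 := by simp [hL]
  have hn : L n = 0 := by simp [hL]
  have hl' : ∀ i : Fin (n - 1), l i = L (i + 1) := fun i => by simp [hL]
  have hstep : ∀ k, k ≤ n → L k = 0 := by
    intro k
    induction k with
    | zero => exact fun _ => h0
    | succ k ih =>
      intro hk
      have h1 := act_diffMatrix_transpose_apply h0 hn hl' ⟨k, hk⟩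
      have h2 : act (diffMatrix n)ᵀ l ⟨k, hk⟩ = 0 := by
        change (Matrix.toEuclideanLin (diffMatrix n)ᵀ l) ⟨k, hk⟩ = 0
        rw [hl]; rfl
      rw [h2, ih (by omega)] at h1
      simpa using h1.symm
  ext i
  rw [hl' i, hstep _ (by omega)]; rfl

/-- All rows of `C` are independent, so the rank condition in `indexSets` always holds. -/
lemma linearIndependent_rowsOf (Q : Finset (Fin (n - 1))) :
    LinearIndependent ℝ (rowsOf (n := n) Q).row := by
  have h : LinearIndependent ℝ (diffMatrix n).row := by
    rw [← Matrix.vecMul_injective_iff]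
    intro u v huv
    have := act_diffMatrix_transpose_injective (n := n) (a₁ := WithLp.toLp 2 u)
      (a₂ := WithLp.toLp 2 v) (by
        ext i
        simpa [Matrix.toLpLin_apply, Matrix.mulVec_transpose] using congrFun huv i)
    simpa using this
  exact h.comp (Subtype.val : Q → Fin (n - 1)) Subtype.val_injective

/-! ### Projection onto the monotone cone -/

lemma convex_monoCone : Convex ℝ (monoCone n) := by
  intro x hx y hy a b ha hb _ i
  have h1 := hx i
  have h2 := hy i
  rw [act_add, act_smul, act_smul]
  simp only [PiLp.add_apply, PiLp.smul_apply, smul_eq_mul]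
  positivity

lemma isClosed_monoCone : IsClosed (monoCone n) := by
  have : monoCone n = ⋂ i, {x | 0 ≤ (act (diffMatrix n) x) i} := by ext; simp [monoCone]
  rw [this]
  refine isClosed_iInter fun i => isClosed_le continuous_const ?_
  have := continuous_act (diffMatrix n)
  fun_prop

lemma projCone_eq_of_forall {z x : Vec n} (hx : x ∈ monoCone n)
    (h : ∀ w ∈ monoCone n, ⟪z - x, w - x⟫_ℝ ≤ 0) : projCone z = x := by
  have hmin : ∃ y, y ∈ monoCone n ∧ IsMinOn (fun y => 1 / 2 * ‖y - z‖ ^ 2) (monoCone n) y :=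
    ⟨x, hx, fun w hw => by
      have h1 := norm_sub_sq_expand w x z
      have h2 := h w hw
      have h3 := sq_nonneg ‖w - x‖
      simp only [mem_ofPred_eq]; linarith⟩
  obtain ⟨h1, h2⟩ := Classical.epsilon_spec hmin
  change projCone z ∈ _ at h1
  have h3 : 1 / 2 * ‖projCone z - z‖ ^ 2 ≤ 1 / 2 * ‖x - z‖ ^ 2 := h2 hx
  have h4 := norm_sub_sq_expand (projCone z) x z
  have h5 := h _ h1
  have h6 : ‖projCone z - x‖ ^ 2 ≤ 0 := by linarith
  have h7 : ‖projCone z - x‖ = 0 := by nlinarith [norm_nonneg (projCone z - x)]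
  exact sub_eq_zero.1 (norm_eq_zero.1 h7)

lemma projCone_spec (z : Vec n) : projCone z ∈ monoCone n ∧
    ∀ w ∈ monoCone n, ⟪z - projCone z, w - projCone z⟫_ℝ ≤ 0 := by
  have hne : (monoCone n).Nonempty := ⟨0, fun i => by simp⟩
  obtain ⟨v, hv, hmin⟩ := exists_norm_eq_iInf_of_complete_convex hne
    isClosed_monoCone.isComplete convex_monoCone z
  have h := (norm_eq_iInf_iff_real_inner_le_zero convex_monoCone hv).1 hmin
  rw [projCone_eq_of_forall hv h]
  exact ⟨hv, h⟩

lemma norm_projCone_sub_le (z z' : Vec n) : ‖projCone z - projCone z'‖ ≤ ‖z - z'‖ := by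
  have h1 := (projCone_spec z).2 _ (projCone_spec z').1
  have h2 := (projCone_spec z').2 _ (projCone_spec z).1
  set x := projCone z
  set x' := projCone z'
  have h3 : ⟪z - x, x' - x⟫_ℝ + ⟪z' - x', x - x'⟫_ℝ = ‖x - x'‖ ^ 2 - ⟪z - z', x - x'⟫_ℝ := by
    rw [← real_inner_self_eq_norm_sq, ← neg_sub x x', inner_neg_right]
    simp only [inner_sub_left]; ring
  have h4 := real_inner_le_norm (z - z') (x - x')
  by_contra! hlt
  have := norm_nonneg (z - z')
  nlinarith

lemma continuous_projCone : Continuous (projCone (n := n)) :=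
  (LipschitzWith.of_dist_le_mul (K := 1) fun z z' => by
    simpa [dist_eq_norm] using norm_projCone_sub_le z z').continuous

/-- The multiplier is explicit: the partial sums of `v = Π(z) - z`. Each is `v` tested against the
indicator of an initial segment, which lies in the cone, so it is nonnegative. -/
lemma multipliers_nonempty (z : Vec n) : (multipliers z).Nonempty := by
  obtain ⟨hx, hvi⟩ := projCone_spec z
  set x := projCone z with hxdef
  set v := x - z with hv
  have hvi' : ∀ w ∈ monoCone n, ⟪v, x⟫_ℝ ≤ ⟪v, w⟫_ℝ := fun w hw => by
    have := hvi w hw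
    rw [← neg_sub x z, inner_neg_left, inner_sub_right] at this
    linarith
  -- The cone contains `0` and `2x`; testing with both gives both inequalities.
  have hvx : ⟪v, x⟫_ℝ = 0 := by
    have h1 := hvi' 0 (fun i => by simp)
    have h2 := hvi' ((2 : ℝ) • x) (fun i => by
      have := hx i
      rw [act_smul]; simp only [PiLp.smul_apply, smul_eq_mul]; positivity)
    rw [inner_zero_right] at h1
    rw [inner_smul_right] at h2
    linarith
  have hpos : ∀ w ∈ monoCone n, 0 ≤ ⟪v, w⟫_ℝ := fun w hw => hvx ▸ hvi' w hw
  set L : ℕ → ℝ := fun k => ∑ j : Fin n, if (j : ℕ) < k then v j else 0 with hL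
  have hind : ∀ (a : ℝ) (k : ℕ),
      ⟪v, WithLp.toLp 2 fun j : Fin n => if (j : ℕ) < k then a else 0⟫_ℝ = a * L k := by
    intro a k
    simp only [EuclideanSpace.inner_eq_star_dotProduct, dotProduct, star_trivial, hL,
      Finset.mul_sum]
    exact Finset.sum_congr rfl fun j _ => by split_ifs <;> simp
  have hLnn : ∀ k, 0 ≤ L k := fun k => by
    rw [← one_mul (L k), ← hind]
    refine hpos _ (mem_monoCone_iff.2 fun i j hij => ?_)
    rw [Fin.le_def] at hij
    change (if (j : ℕ) < k then (1 : ℝ) else 0) ≤ if (i : ℕ) < k then (1 : ℝ) else 0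
    split_ifs <;> first | omega | norm_num
  have h0 : L 0 = 0 := by simp [hL]
  -- Constant vectors of either sign are monotone, so the total sum vanishes.
  have hn : L n = 0 := by
    refine le_antisymm ?_ (hLnn n)
    have : 0 ≤ (-1) * L n := by
      rw [← hind]
      refine hpos _ (mem_monoCone_iff.2 fun i j hij => ?_)
      simp
    linarith
  set l : Vec (n - 1) := WithLp.toLp 2 fun i : Fin (n - 1) => L (i + 1) with hl
  have hCl : act (diffMatrix n)ᵀ l = v := by
    ext j
    rw [act_diffMatrix_transpose_apply h0 hn (fun i => rfl), hL, ← Finset.sum_sub_distrib,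
      Finset.sum_eq_single j]
    · simp
    · intro b _ hb
      have : (b : ℕ) ≠ j := fun h => hb (Fin.ext h)
      split_ifs <;> first | omega | simp
    · simp
  refine ⟨l, by rw [hCl]; exact sub_self _, hx, fun i => hLnn _, ?_⟩
  have hsum : ∑ i, l i * (act (diffMatrix n) x) i = 0 := by
    rw [← hvx, ← hCl, inner_act_transpose]
    simp only [EuclideanSpace.inner_eq_star_dotProduct, dotProduct, star_trivial]
    exact Finset.sum_congr rfl fun i _ => mul_comm _ _
  have := (Finset.sum_eq_zero_iff_of_nonneg
    fun (i : Fin (n - 1)) _ => mul_nonneg (hLnn (i + 1)) (hx i)).1 hsum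
  exact fun i => this i (Finset.mem_univ i)

end Cone

/-! ### Regions of affinity of the projection -/

section Regions

variable {n : ℕ} {Q : Finset (Fin (n - 1))}

/-- The Karush-Kuhn-Tucker conditions of `min {½‖x - z‖² | C x ≥ 0}` with the support of the
multiplier inside `Q` and `Q` inside the active set. -/
structure IsKKT (Q : Finset (Fin (n - 1))) (z x : Vec n) (l : Vec (n - 1)) : Prop where
  mem : x ∈ monoCone n
  nonneg : ∀ i, 0 ≤ l i
  supp : ∀ i ∉ Q, l i = 0
  active : ∀ i ∈ Q, act (diffMatrix n) x i = 0
  stat : x - z = act (diffMatrix n)ᵀ l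

lemma IsKKT.projCone_eq {z x : Vec n} {l : Vec (n - 1)} (h : IsKKT Q z x l) :
    projCone z = x := by
  refine projCone_eq_of_forall h.mem fun w hw => ?_
  rw [← neg_sub x z, h.stat, inner_neg_left, inner_act_transpose, act_sub, neg_nonpos]
  simp only [EuclideanSpace.inner_eq_star_dotProduct, dotProduct, star_trivial]
  refine Finset.sum_nonneg fun i _ => ?_
  by_cases hi : i ∈ Q
  · refine mul_nonneg ?_ (h.nonneg i)
    simp only [PiLp.sub_apply, h.active i hi, sub_zero]
    exact hw i
  · simp [h.supp i hi]

lemma mem_indexSets_iff {z : Vec n} : Q ∈ indexSets z ↔ ∃ l, IsKKT Q z (projCone z) l := by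
  constructor
  · rintro ⟨⟨l, ⟨h1, h2, h3, h4⟩, h5⟩, h6, -⟩
    exact ⟨l, h2, h3, fun i hi => by_contra fun hne => hi (h5 i hne), h6, sub_eq_zero.1 h1⟩
  · rintro ⟨l, h⟩
    refine ⟨⟨l, ⟨sub_eq_zero.2 h.stat, h.mem, h.nonneg, fun i => ?_⟩, fun i hne => ?_⟩,
      h.active, linearIndependent_rowsOf Q⟩
    · by_cases hi : i ∈ Q
      · rw [h.active i hi, mul_zero]
      · rw [h.supp i hi, zero_mul]
    · exact by_contra fun hi => hne (h.supp i hi)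

lemma indexSets_nonempty (z : Vec n) : (indexSets z).Nonempty := by
  classical
  obtain ⟨l, h1, h2, h3, h4⟩ := multipliers_nonempty z
  refine ⟨Finset.univ.filter fun i => l i ≠ 0, mem_indexSets_iff.2 ⟨l, h2, h3, ?_, ?_,
    sub_eq_zero.1 h1⟩⟩
  · simp
  · intro i hi
    exact (mul_eq_zero.1 (h4 i)).resolve_left (Finset.mem_filter.1 hi).2

/-- Complementarity, the only bilinear KKT condition, is encoded in the fixed `Q`; the remaining
conditions are convex jointly in `(z, x, l)`. -/
lemma IsKKT.segment {z x z' x' : Vec n} {l l' : Vec (n - 1)} (h : IsKKT Q z x l)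
    (h' : IsKKT Q z' x' l') {t : ℝ} (ht : t ∈ Icc (0 : ℝ) 1) :
    IsKKT Q (z + t • (z' - z)) (x + t • (x' - x)) (l + t • (l' - l)) where
  mem := by
    have := convex_monoCone h.mem h'.mem (sub_nonneg.2 ht.2) ht.1 (by ring)
    convert this using 1
    module
  nonneg i := by
    have h1 := h.nonneg i
    have h2 := h'.nonneg i
    have h3 := sub_nonneg.2 ht.2
    have h4 := ht.1
    have : (l + t • (l' - l)) i = (1 - t) * l i + t * l' i := by simp; ring
    rw [this]; positivity
  supp i hi := by simp [h.supp i hi, h'.supp i hi]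
  active i hi := by
    have h1 := h.active i hi
    have h2 := h'.active i hi
    rw [act_add, act_smul, act_sub]
    simp only [PiLp.add_apply, PiLp.smul_apply, PiLp.sub_apply]
    rw [h1, h2]; simp
  stat := by
    rw [act_add, act_smul, act_sub, ← h.stat, ← h'.stat]
    module

/-- The orthogonal projector `I - C_Qᵀ (C_Q C_Qᵀ)⁻¹ C_Q` onto the kernel of `C_Q`. -/
noncomputable def kerProjector (Q : Finset (Fin (n - 1))) : Matrix (Fin n) (Fin n) ℝ :=
  1 - (rowsOf Q)ᵀ * (rowsOf Q * (rowsOf Q)ᵀ)⁻¹ * rowsOf Q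

lemma isUnit_gram (Q : Finset (Fin (n - 1))) :
    IsUnit (rowsOf (n := n) Q * (rowsOf Q)ᵀ).det := by
  have h := Matrix.PosDef.mul_conjTranspose_self (rowsOf (n := n) Q)
    (Matrix.vecMul_injective_iff.2 (linearIndependent_rowsOf Q))
  rw [Matrix.conjTranspose_eq_transpose_of_trivial] at h
  exact (Matrix.isUnit_iff_isUnit_det _).1 h.isUnit

/-- Here `C_Q x = 0` and `x - z` lies in the range of `C_Qᵀ`, which characterizes the projection of
`z` onto the kernel of `C_Q`. -/
lemma IsKKT.eq_act_kerProjector {z x : Vec n} {l : Vec (n - 1)} (h : IsKKT Q z x l) :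
    x = act (kerProjector Q) z := by
  have h1 : rowsOf Q *ᵥ x.ofLp = 0 := by
    ext i
    exact h.active i.1 i.2
  have h2 : x.ofLp - z.ofLp = (rowsOf Q)ᵀ *ᵥ (fun i : Q => l i) := by
    ext j
    have h3 := congrArg (fun v : Vec n => v j) h.stat
    simp only [PiLp.sub_apply] at h3
    rw [Pi.sub_apply, h3]
    change ∑ i, (diffMatrix n)ᵀ j i * l i = ∑ i : Q, (diffMatrix n)ᵀ j i * l i
    rw [← Finset.sum_subset (Finset.subset_univ Q)
      (fun i _ hi => by rw [h.supp i hi, mul_zero]), ← Finset.sum_coe_sort Q]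
  have h3 : z.ofLp = x.ofLp - (rowsOf Q)ᵀ *ᵥ (fun i : Q => l i) := by rw [← h2]; abel
  have h4 : rowsOf Q *ᵥ z.ofLp = -((rowsOf Q * (rowsOf Q)ᵀ) *ᵥ (fun i : Q => l i)) := by
    rw [h3, Matrix.mulVec_sub, h1, zero_sub, Matrix.mulVec_mulVec]
  have h5 : x.ofLp = kerProjector Q *ᵥ z.ofLp := by
    rw [kerProjector, Matrix.sub_mulVec, Matrix.one_mulVec, ← Matrix.mulVec_mulVec, h4,
      Matrix.mulVec_neg, ← Matrix.mulVec_mulVec, Matrix.mulVec_mulVec _ _ (_ * _),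
      Matrix.nonsing_inv_mul _ (isUnit_gram Q), Matrix.one_mulVec, ← h2]
    abel
  ext i
  exact congrFun h5 i

/-- Since `Cᵀ` is injective, the multiplier is unique and depends continuously on `z` through a left
inverse `g`. The existential thus becomes a list of closed conditions. -/
lemma isClosed_setOf_mem_indexSets (Q : Finset (Fin (n - 1))) :
    IsClosed {z : Vec n | Q ∈ indexSets z} := by
  obtain ⟨g, hg⟩ := LinearMap.exists_leftInverse_of_injective
    (Matrix.toEuclideanLin (diffMatrix n)ᵀ) (LinearMap.ker_eq_bot.2
      act_diffMatrix_transpose_injective)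
  have hg' : ∀ l, g (act (diffMatrix n)ᵀ l) = l := fun l => LinearMap.congr_fun hg l
  have hgc : Continuous g := LinearMap.continuous_of_finiteDimensional g
  have hC := continuous_act (diffMatrix n)
  have hCt := continuous_act (diffMatrix n)ᵀ
  have hp := continuous_projCone (n := n)
  have hset : {z : Vec n | Q ∈ indexSets z} =
      {z | projCone z - z = act (diffMatrix n)ᵀ (g (projCone z - z))} ∩
      ((⋂ i, {z | 0 ≤ g (projCone z - z) i}) ∩
      ((⋂ i, ⋂ _ : i ∉ Q, {z | g (projCone z - z) i = 0}) ∩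
        ⋂ i, ⋂ _ : i ∈ Q, {z | act (diffMatrix n) (projCone z) i = 0})) := by
    ext z
    simp only [mem_inter_iff, mem_iInter, mem_ofPred_eq, mem_indexSets_iff]
    constructor
    · rintro ⟨l, h⟩
      have hl : g (projCone z - z) = l := by rw [h.stat, hg']
      rw [hl]
      exact ⟨h.stat, h.nonneg, h.supp, h.active⟩
    · rintro ⟨h1, h2, h3, h4⟩
      exact ⟨_, (projCone_spec z).1, h2, h3, h4, h1⟩
  rw [hset]
  refine (isClosed_eq (by fun_prop) (hCt.comp (by fun_prop))).inter ((isClosed_iInter fun i =>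
    isClosed_le continuous_const (by fun_prop)).inter ((isClosed_iInter fun i =>
    isClosed_iInter fun _ => isClosed_eq (by fun_prop) continuous_const).inter
    (isClosed_iInter fun i => isClosed_iInter fun _ => isClosed_eq ?_ continuous_const)))
  have := hC.comp hp
  exact (PiLp.continuous_apply 2 _ i).comp this

end Regions

/-! ### Permutations -/

section Perm

variable {n : ℕ}

lemma act_permMatrix_apply (P : Equiv.Perm (Fin n)) (u : Vec n) (i : Fin n) :
    act (P.permMatrix ℝ) u i = u (P i) := by
  simp [Matrix.toLpLin_apply, Matrix.permMatrix_mulVec]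

lemma act_permMatrix_transpose_act (P : Equiv.Perm (Fin n)) (u : Vec n) :
    act (P.permMatrix ℝ)ᵀ (act (P.permMatrix ℝ) u) = u := by
  ext i
  rw [Matrix.transpose_permMatrix, act_permMatrix_apply, act_permMatrix_apply]; simp

lemma act_permMatrix_act_transpose (P : Equiv.Perm (Fin n)) (u : Vec n) :
    act (P.permMatrix ℝ) (act (P.permMatrix ℝ)ᵀ u) = u := by
  ext i
  rw [Matrix.transpose_permMatrix, act_permMatrix_apply, act_permMatrix_apply]; simp

lemma inner_act_permMatrix (P : Equiv.Perm (Fin n)) (u v : Vec n) :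
    ⟪act (P.permMatrix ℝ) u, act (P.permMatrix ℝ) v⟫_ℝ = ⟪u, v⟫_ℝ := by
  rw [← inner_act_transpose, act_permMatrix_transpose_act]

lemma norm_act_permMatrix (P : Equiv.Perm (Fin n)) (u : Vec n) :
    ‖act (P.permMatrix ℝ) u‖ = ‖u‖ := by
  rw [norm_eq_sqrt_real_inner, inner_act_permMatrix, ← norm_eq_sqrt_real_inner]

lemma exists_sorts (y : Vec n) : ∃ P, Sorts P y := by
  refine ⟨Tuple.sort (fun i => -y i), fun i j hij => ?_⟩
  have := Tuple.monotone_sort (fun i => -y i) hij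
  simpa using this

lemma sorts_iff {P : Equiv.Perm (Fin n)} {y : Vec n} :
    Sorts P y ↔ act (P.permMatrix ℝ) y ∈ monoCone n := by
  rw [mem_monoCone_iff]
  have : (act (P.permMatrix ℝ) y).ofLp = fun i => y (P i) := by
    ext i; exact act_permMatrix_apply P y i
  rw [this]; rfl

lemma isClosed_setOf_sorts (P : Equiv.Perm (Fin n)) : IsClosed {y : Vec n | Sorts P y} := by
  simp only [sorts_iff]
  exact isClosed_monoCone.preimage (continuous_act _)

/-- The rearrangement inequality: sorting decreases distances. -/
lemma norm_sort_sub_sort_le {P T : Equiv.Perm (Fin n)} {y u : Vec n} (hP : Sorts P y)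
    (hT : Sorts T u) :
    ‖act (T.permMatrix ℝ) u - act (P.permMatrix ℝ) y‖ ≤ ‖u - y‖ := by
  have hin : ⟪u, y⟫_ℝ ≤ ⟪act (T.permMatrix ℝ) u, act (P.permMatrix ℝ) y⟫_ℝ := by
    rw [← inner_act_permMatrix P u y]
    simp only [EuclideanSpace.inner_eq_star_dotProduct, dotProduct, star_trivial,
      act_permMatrix_apply]
    have hm : Monovary (fun i => y (P i)) fun i => u (T i) := hP.monovary hT
    have := hm.sum_mul_comp_perm_le_sum_mul (σ := T⁻¹ * P)
    simpa using this
  have h1 := norm_sub_sq_real u y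
  have h2 := norm_sub_sq_real (act (T.permMatrix ℝ) u) (act (P.permMatrix ℝ) y)
  rw [norm_act_permMatrix, norm_act_permMatrix] at h2
  exact (sq_le_sq₀ (norm_nonneg _) (norm_nonneg _)).1 (by linarith)

end Perm

/-! ### The rank loss -/

section Rank

variable {n : ℕ}

/-- In the symmetric double sum, permutation invariance is mere reindexing. -/
lemma sum_sum_Ioi_abs (u : Vec n) :
    2 * ∑ i : Fin n, ∑ j ∈ Finset.Ioi i, |u i - u j| = ∑ i : Fin n, ∑ j : Fin n, |u i - u j| := by
  have h := Finset.sum_sum_Ioi_add_eq_sum_sum_off_diag (fun i j : Fin n => |u i - u j|)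
  have h1 : ∀ i j : Fin n, |u j - u i| + |u i - u j| = 2 * |u i - u j| := fun i j => by
    rw [abs_sub_comm]; ring
  simp only [h1, ← Finset.mul_sum] at h
  rw [h]
  refine Finset.sum_congr rfl fun i _ => ?_
  rw [← Finset.sum_compl_add_sum {i}]
  simp [abs_sub_comm]

lemma rankLoss_act_permMatrix (P : Equiv.Perm (Fin n)) (u : Vec n) :
    rankLoss (act (P.permMatrix ℝ) u) = rankLoss u := by
  unfold rankLoss
  congr 1
  refine mul_left_cancel₀ (two_ne_zero (α := ℝ)) ?_
  rw [sum_sum_Ioi_abs, sum_sum_Ioi_abs]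
  simp only [act_permMatrix_apply]
  rw [Equiv.sum_comp P (fun i => ∑ j, |u i - u (P j)|)]
  exact Finset.sum_congr rfl fun i _ => Equiv.sum_comp P (fun j => |u i - u j|)

lemma rankLoss_of_mem_monoCone {s : Vec n} (hs : s ∈ monoCone n) :
    rankLoss s = 2 / ((n : ℝ) * ((n : ℝ) - 1)) * ⟪weight n, s⟫_ℝ := by
  unfold rankLoss
  congr 1
  have h1 : ∀ i : Fin n, ∑ j ∈ Finset.Ioi i, |s i - s j| =
      ((n : ℝ) - 1 - i) * s i - ∑ j ∈ Finset.Ioi i, s j := by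
    intro i
    have : ∀ j ∈ Finset.Ioi i, |s i - s j| = s i - s j := fun j hj =>
      abs_of_nonneg (sub_nonneg.2 (mem_monoCone_iff.1 hs (Finset.mem_Ioi.1 hj).le))
    rw [Finset.sum_congr rfl this, Finset.sum_sub_distrib, Finset.sum_const, Fin.card_Ioi,
      nsmul_eq_mul]
    have hi := i.2
    rw [Nat.cast_sub (by omega), Nat.cast_sub (by omega)]
    simp
  have h2 : ∑ i : Fin n, ∑ j ∈ Finset.Ioi i, s j = ∑ j : Fin n, (j : ℝ) * s j := by
    rw [Finset.sum_comm' (t' := Finset.univ) (s' := fun j => Finset.Iio j) (by simp)]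
    exact Finset.sum_congr rfl fun j _ => by simp
  simp only [h1, Finset.sum_sub_distrib, h2, EuclideanSpace.inner_eq_star_dotProduct, dotProduct,
    star_trivial, weight]
  rw [← Finset.sum_sub_distrib]
  exact Finset.sum_congr rfl fun i _ => by ring

lemma convexOn_rankLoss {tau : ℝ} (htau : 0 ≤ tau) :
    ConvexOn ℝ univ fun u : Vec n => tau * rankLoss u := by
  have hc : 0 ≤ 2 / ((n : ℝ) * ((n : ℝ) - 1)) := by
    -- For `n = 0` the factor `n - 1` is negative, but the quotient is `2 / 0 = 0`.
    rcases Nat.eq_zero_or_pos n with h | h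
    · simp [h]
    · have : (1 : ℝ) ≤ n := by exact_mod_cast h
      have : 0 ≤ (n : ℝ) - 1 := by linarith
      positivity
  refine ⟨convex_univ, fun x _ y _ a b ha hb _ => ?_⟩
  have h : ∑ i : Fin n, ∑ j ∈ Finset.Ioi i, |(a • x + b • y) i - (a • x + b • y) j| ≤
      a * (∑ i : Fin n, ∑ j ∈ Finset.Ioi i, |x i - x j|) +
        b * ∑ i : Fin n, ∑ j ∈ Finset.Ioi i, |y i - y j| := by
    simp only [Finset.mul_sum, ← Finset.sum_add_distrib]
    refine Finset.sum_le_sum fun i _ => Finset.sum_le_sum fun j _ => ?_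
    have : (a • x + b • y) i - (a • x + b • y) j = a * (x i - x j) + b * (y i - y j) := by
      simp; ring
    rw [this]
    refine (abs_add_le _ _).trans ?_
    rw [abs_mul, abs_mul, abs_of_nonneg ha, abs_of_nonneg hb]
  have h2 := mul_le_mul_of_nonneg_left h (mul_nonneg htau hc)
  simp only [rankLoss, smul_eq_mul]
  linarith

/-- The proximal mapping of the rank loss is obtained by sorting, shifting, projecting onto the
monotone cone and undoing the sorting. -/
lemma isProxPoint_rankLoss {tau : ℝ} (htau : 0 ≤ tau) {P : Equiv.Perm (Fin n)} {y : Vec n}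
    (hP : Sorts P y) :
    IsProxPoint (fun u : Vec n => tau * rankLoss u) y
      (act (P.permMatrix ℝ)ᵀ (projCone (shifted tau P y))) := by
  refine isProxPoint_of_isMin (convexOn_rankLoss htau) fun u => ?_
  -- Sorting the competitor `u` keeps its loss and does not increase its distance to the sorted `y`,
  -- so comparison within the cone suffices.
  obtain ⟨T, hT⟩ := exists_sorts u
  set z := shifted tau P y with hz
  set x := projCone z with hx
  obtain ⟨hxm, hvi⟩ := projCone_spec z
  rw [← hx] at hxm hvi
  set s := act (T.permMatrix ℝ) u with hs
  have hsm : s ∈ monoCone n := sorts_iff.1 hT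
  have h1 : rankLoss (act (P.permMatrix ℝ)ᵀ x) = rankLoss x := by
    rw [← rankLoss_act_permMatrix P, act_permMatrix_act_transpose]
  have h2 : ‖act (P.permMatrix ℝ)ᵀ x - y‖ = ‖x - act (P.permMatrix ℝ) y‖ := by
    rw [← norm_act_permMatrix P, act_sub, act_permMatrix_act_transpose]
  have h3 : ‖s - act (P.permMatrix ℝ) y‖ ^ 2 ≤ ‖u - y‖ ^ 2 := by
    gcongr; exact norm_sort_sub_sort_le hP hT
  simp only [h1, h2, ← rankLoss_act_permMatrix T u, ← hs, rankLoss_of_mem_monoCone hsm,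
    rankLoss_of_mem_monoCone hxm]
  have hexp := norm_sub_sq_expand s x z
  have hvi' := hvi s hsm
  have hsx := sq_nonneg ‖s - x‖
  -- On the cone the loss is linear, so completing the square absorbs it into the shift: projecting
  -- `z` minimizes the proximal objective there.
  have hzy : ∀ v : Vec n, ‖v - z‖ ^ 2 = ‖v - act (P.permMatrix ℝ) y‖ ^ 2 +
      2 * (2 * tau / ((n : ℝ) * ((n : ℝ) - 1))) * (⟪weight n, v⟫_ℝ
        - ⟪weight n, act (P.permMatrix ℝ) y⟫_ℝ) +
      ‖(2 * tau / ((n : ℝ) * ((n : ℝ) - 1))) • weight n‖ ^ 2 := by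
    intro v
    have : v - z = (v - act (P.permMatrix ℝ) y) +
        (2 * tau / ((n : ℝ) * ((n : ℝ) - 1))) • weight n := by
      rw [hz, shifted]; abel
    rw [this, norm_add_sq_real, inner_smul_right, real_inner_comm, inner_sub_right]
    ring
  rw [hzy s, hzy x] at hexp
  have hct : tau * (2 / ((n : ℝ) * ((n : ℝ) - 1))) = 2 * tau / ((n : ℝ) * ((n : ℝ) - 1)) := by
    ring
  rw [← mul_assoc, ← mul_assoc, hct]
  linarith

lemma prox_rankLoss_eq {tau : ℝ} (htau : 0 ≤ tau) {P : Equiv.Perm (Fin n)} {y : Vec n}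
    (hP : Sorts P y) : prox (fun u : Vec n => tau * rankLoss u) y =
      act (P.permMatrix ℝ)ᵀ (projCone (shifted tau P y)) :=
  (isProxPoint_rankLoss htau hP).prox_eq

lemma isProxPoint_prox_rankLoss {tau : ℝ} (htau : 0 ≤ tau) (y : Vec n) :
    IsProxPoint (fun u : Vec n => tau * rankLoss u) y
      (prox (fun u : Vec n => tau * rankLoss u) y) := by
  obtain ⟨P, hP⟩ := exists_sorts y
  rw [prox_rankLoss_eq htau hP]
  exact isProxPoint_rankLoss htau hP

lemma rankJacobian_nonempty (tau : ℝ) (y : Vec n) : (rankJacobian tau y).Nonempty := by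
  obtain ⟨P, hP⟩ := exists_sorts y
  obtain ⟨Q, hQ⟩ := indexSets_nonempty (shifted tau P y)
  exact ⟨_, P, hP, Q, hQ, rfl⟩

lemma continuous_shifted (tau : ℝ) (P : Equiv.Perm (Fin n)) : Continuous (shifted tau P) :=
  (continuous_act _).sub continuous_const

/-- Near `y₀` the proximal mapping of the rank loss is affine on segments from `y₀`, with every
element of `𝓜(y)` as slope. -/
lemma eventually_prox_rankLoss_segment {tau : ℝ} (htau : 0 ≤ tau) (y₀ : Vec n) :
    ∀ᶠ y in 𝓝 y₀, ∀ V ∈ rankJacobian tau y, ∀ t ∈ Icc (0 : ℝ) 1,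
      prox (fun u : Vec n => tau * rankLoss u) (y₀ + t • (y - y₀)) =
        prox (fun u : Vec n => tau * rankLoss u) y₀ + t • act V (y - y₀) := by
  -- Finitely many closed sets: a neighbourhood of `y₀` misses all those that do not contain `y₀`.
  have hev : ∀ᶠ y in 𝓝 y₀, ∀ (P : Equiv.Perm (Fin n)) (Q : Finset (Fin (n - 1))),
      Sorts P y ∧ Q ∈ indexSets (shifted tau P y) →
        Sorts P y₀ ∧ Q ∈ indexSets (shifted tau P y₀) := by
    rw [eventually_all]; intro P
    rw [eventually_all]; intro Q
    have hcl : IsClosed {y : Vec n | Sorts P y ∧ Q ∈ indexSets (shifted tau P y)} :=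
      (isClosed_setOf_sorts P).inter
        ((isClosed_setOf_mem_indexSets Q).preimage (continuous_shifted tau P))
    by_cases h : Sorts P y₀ ∧ Q ∈ indexSets (shifted tau P y₀)
    · exact Eventually.of_forall fun _ _ => h
    · filter_upwards [hcl.isOpen_compl.mem_nhds h] with y hy h' using absurd h' hy
  filter_upwards [hev] with y hy
  rintro V ⟨P, hP, Q, hQ, rfl⟩ t ht
  obtain ⟨hP₀, hQ₀⟩ := hy P Q ⟨hP, hQ⟩
  obtain ⟨l, hl⟩ := mem_indexSets_iff.1 hQ
  obtain ⟨l₀, hl₀⟩ := mem_indexSets_iff.1 hQ₀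
  have hPt : Sorts P (y₀ + t • (y - y₀)) := by
    rw [sorts_iff] at *
    have := convex_monoCone hP₀ hP (sub_nonneg.2 ht.2) ht.1 (by ring)
    rw [act_add, act_smul, act_sub]
    convert this using 1
    module
  have hz : shifted tau P (y₀ + t • (y - y₀)) =
      shifted tau P y₀ + t • (shifted tau P y - shifted tau P y₀) := by
    simp only [shifted, act_add, act_smul, act_sub]
    module
  have hx : projCone (shifted tau P y) - projCone (shifted tau P y₀) =
      act (kerProjector Q) (act (P.permMatrix ℝ) (y - y₀)) := by
    rw [hl.eq_act_kerProjector, hl₀.eq_act_kerProjector, ← act_sub]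
    congr 1
    simp only [shifted, act_sub]
    abel
  rw [prox_rankLoss_eq htau hPt, hz, (hl₀.segment hl ht).projCone_eq, prox_rankLoss_eq htau hP₀,
    hx, act_add, act_smul, act_mul, act_mul]
  rfl

/-- Orthogonal projectors: symmetric idempotent matrices. -/
structure IsOrthProjector {n : ℕ} (E : Matrix (Fin n) (Fin n) ℝ) : Prop where
  symm : Eᵀ = E
  idem : E * E = E

lemma IsOrthProjector.inner_act {E : Matrix (Fin n) (Fin n) ℝ} (hE : IsOrthProjector E)
    (v : Vec n) : ⟪v, act E v⟫_ℝ = ‖act E v‖ ^ 2 := by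
  rw [← real_inner_self_eq_norm_sq]
  conv_rhs => rw [← hE.symm, inner_act_transpose, hE.symm, ← act_mul, hE.idem]

lemma IsOrthProjector.norm_act_le {E : Matrix (Fin n) (Fin n) ℝ} (hE : IsOrthProjector E)
    (v : Vec n) : ‖act E v‖ ≤ ‖v‖ := by
  have h1 := hE.inner_act v
  have h2 := real_inner_le_norm v (act E v)
  by_contra! h
  nlinarith [norm_nonneg v]

lemma isOrthProjector_one_sub_of_mem_rankJacobian {tau : ℝ} {y : Vec n}
    {V : Matrix (Fin n) (Fin n) ℝ} (hV : V ∈ rankJacobian tau y) : IsOrthProjector (1 - V) := by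
  obtain ⟨P, -, Q, -, rfl⟩ := hV
  set R := rowsOf (n := n) Q
  set G := R * Rᵀ with hG
  have hGu := isUnit_gram (n := n) Q
  have hP1 : (P.permMatrix ℝ)ᵀ * P.permMatrix ℝ = 1 := by
    rw [Matrix.transpose_permMatrix, ← Matrix.permMatrix_mul]; simp
  have hP2 : P.permMatrix ℝ * (P.permMatrix ℝ)ᵀ = 1 := by
    rw [Matrix.transpose_permMatrix, ← Matrix.permMatrix_mul]; simp
  have hGs : (G⁻¹)ᵀ = G⁻¹ := by
    rw [Matrix.transpose_nonsing_inv, hG, Matrix.transpose_mul, Matrix.transpose_transpose]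
  have h : (1 : Matrix (Fin n) (Fin n) ℝ) - (P.permMatrix ℝ)ᵀ * (1 - Rᵀ * G⁻¹ * R) * P.permMatrix ℝ
      = (P.permMatrix ℝ)ᵀ * (Rᵀ * G⁻¹ * R) * P.permMatrix ℝ := by
    rw [Matrix.mul_sub, Matrix.sub_mul, Matrix.mul_one, hP1, sub_sub_cancel]
  rw [h]
  constructor
  · simp only [Matrix.transpose_mul, Matrix.transpose_transpose, hGs, Matrix.mul_assoc]
  · have hGi : G⁻¹ * (R * (Rᵀ * G⁻¹)) = G⁻¹ := by
      rw [← Matrix.mul_assoc R, ← hG, Matrix.mul_nonsing_inv _ hGu, Matrix.mul_one]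
    calc _ = (P.permMatrix ℝ)ᵀ * Rᵀ * G⁻¹ * R * (P.permMatrix ℝ * (P.permMatrix ℝ)ᵀ) *
          Rᵀ * G⁻¹ * R * P.permMatrix ℝ := by simp only [Matrix.mul_assoc]
      _ = (P.permMatrix ℝ)ᵀ * Rᵀ * (G⁻¹ * (R * (Rᵀ * G⁻¹))) * R * P.permMatrix ℝ := by
          rw [hP2]; simp only [Matrix.mul_assoc, Matrix.one_mul]
      _ = _ := by rw [hGi]; simp only [Matrix.mul_assoc]

end Rank

/-! ### Soft thresholding -/

/-- The scalar soft-thresholding function, the proximal mapping of `κ |·|`. -/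
noncomputable def softThr (κ a : ℝ) : ℝ :=
  if κ < a then a - κ else if a < -κ then a + κ else 0

section Soft

variable {κ : ℝ}

lemma softThr_subgradient (hκ : 0 ≤ κ) (a b : ℝ) :
    κ * |softThr κ a| + (a - softThr κ a) * (b - softThr κ a) ≤ κ * |b| := by
  unfold softThr
  split_ifs with h1 h2
  · rw [abs_of_pos (by linarith)]
    nlinarith [le_abs_self b]
  · rw [abs_of_neg (by linarith)]
    nlinarith [neg_abs_le b]
  · rw [abs_zero, sub_zero, sub_zero, mul_zero, zero_add]
    calc a * b ≤ |a * b| := le_abs_self _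
      _ = |a| * |b| := abs_mul _ _
      _ ≤ κ * |b| := by
        gcongr
        exact abs_le.2 ⟨by linarith, by linarith⟩

lemma monotone_softThr : Monotone (softThr κ) := by
  intro a b hab
  unfold softThr
  split_ifs <;> linarith

/-- This monotonicity bounds the derivatives of soft thresholding by one. -/
lemma monotone_sub_softThr (hκ : 0 ≤ κ) : Monotone fun a => a - softThr κ a := by
  intro a b hab
  simp only [softThr]
  split_ifs <;> linarith

lemma hasDerivAt_softThr_of_lt {a : ℝ} (h : |a| < κ) : HasDerivAt (softThr κ) 0 a := by
  refine (hasDerivAt_const a (0 : ℝ)).congr_of_eventuallyEq ?_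
  filter_upwards [continuous_abs.continuousAt.eventually_lt continuousAt_const h] with b hb
  rw [abs_lt] at hb
  rw [softThr, if_neg (by linarith), if_neg (by linarith)]

lemma hasDerivAt_softThr_of_gt (hκ : 0 ≤ κ) {a : ℝ} (h : κ < |a|) :
    HasDerivAt (softThr κ) 1 a := by
  rcases lt_abs.1 h with h | h
  · refine ((hasDerivAt_id a).sub_const κ).congr_of_eventuallyEq ?_
    filter_upwards [lt_mem_nhds h] with b hb
    rw [softThr, if_pos hb]; rfl
  · refine ((hasDerivAt_id a).add_const κ).congr_of_eventuallyEq ?_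
    filter_upwards [gt_mem_nhds (show a < -κ by linarith)] with b hb
    rw [softThr, if_neg (by linarith), if_pos hb]; rfl

lemma hasDerivAt_softThr_mem_Icc (hκ : 0 ≤ κ) {a θ : ℝ} (h : HasDerivAt (softThr κ) θ a) :
    θ ∈ Icc (0 : ℝ) 1 := by
  constructor
  · rw [← h.deriv]; exact monotone_softThr.deriv_nonneg
  · have h1 := (hasDerivAt_id a).sub h
    have h2 : 0 ≤ deriv (fun a => a - softThr κ a) a := (monotone_sub_softThr hκ).deriv_nonneg
    have h3 : deriv (fun a => a - softThr κ a) a = 1 - θ := h1.deriv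
    linarith

/-- `θ` is a generalized derivative of soft thresholding at `a`. -/
structure IsSoftSlope (κ a θ : ℝ) : Prop where
  nonneg : 0 ≤ θ
  le_one : θ ≤ 1
  inside : |a| < κ → θ = 0
  outside : κ < |a| → θ = 1

/-- A point `a` near `a₀` shares with it a closed linear piece of slope `θ`, and this piece, an
interval, contains the segment. If `a` is a kink, nearness forces `a = a₀` and `θ` is irrelevant. -/
lemma eventually_softThr_segment (hκ : 0 < κ) (a₀ : ℝ) :
    ∀ᶠ a in 𝓝 a₀, ∀ θ, IsSoftSlope κ a θ → ∀ t ∈ Icc (0 : ℝ) 1,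
      softThr κ (a₀ + t * (a - a₀)) = softThr κ a₀ + t * (θ * (a - a₀)) := by
  have h1 : ∀ᶠ a in 𝓝 a₀, κ < a₀ → κ < a := by
    by_cases h : κ < a₀
    · filter_upwards [lt_mem_nhds h] with a ha _ using ha
    · exact Eventually.of_forall fun a h' => absurd h' h
  have h2 : ∀ᶠ a in 𝓝 a₀, a₀ < κ → a < κ := by
    by_cases h : a₀ < κ
    · filter_upwards [gt_mem_nhds h] with a ha _ using ha
    · exact Eventually.of_forall fun a h' => absurd h' h
  have h3 : ∀ᶠ a in 𝓝 a₀, -κ < a₀ → -κ < a := by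
    by_cases h : -κ < a₀
    · filter_upwards [lt_mem_nhds h] with a ha _ using ha
    · exact Eventually.of_forall fun a h' => absurd h' h
  have h4 : ∀ᶠ a in 𝓝 a₀, a₀ < -κ → a < -κ := by
    by_cases h : a₀ < -κ
    · filter_upwards [gt_mem_nhds h] with a ha _ using ha
    · exact Eventually.of_forall fun a h' => absurd h' h
  filter_upwards [h1, h2, h3, h4] with a h1 h2 h3 h4 θ hθ t ht
  obtain ⟨ht0, ht1⟩ := ht
  have hb : (a ≤ a₀ ∧ a - a₀ ≤ t * (a - a₀) ∧ t * (a - a₀) ≤ 0) ∨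
      (a₀ ≤ a ∧ 0 ≤ t * (a - a₀) ∧ t * (a - a₀) ≤ a - a₀) := by
    rcases le_total a a₀ with h | h
    · exact Or.inl ⟨h, by nlinarith, by nlinarith⟩
    · exact Or.inr ⟨h, by nlinarith, by nlinarith⟩
  have hcomm : t * (θ * (a - a₀)) = θ * (t * (a - a₀)) := by ring
  rw [hcomm]
  set b := t * (a - a₀) with hbdef
  have hcases : (κ ≤ a ∧ κ ≤ a₀ ∧ (θ = 1 ∨ b = 0)) ∨ (a ≤ -κ ∧ a₀ ≤ -κ ∧ (θ = 1 ∨ b = 0)) ∨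
      (-κ ≤ a ∧ a ≤ κ ∧ -κ ≤ a₀ ∧ a₀ ≤ κ ∧ (θ = 0 ∨ b = 0)) := by
    have hb0 : a = a₀ → b = 0 := fun h => by rw [hbdef, h]; ring
    rcases lt_trichotomy a κ with ha | ha | ha
    · rcases lt_trichotomy a (-κ) with ha' | ha' | ha'
      · refine Or.inr (Or.inl ⟨ha'.le, ?_, Or.inl (hθ.outside (lt_abs.2 (Or.inr (by linarith))))⟩)
        by_contra! h; linarith [h3 h]
      · rcases lt_trichotomy a₀ (-κ) with h | h | h
        · linarith [h4 h]
        · exact Or.inr (Or.inl ⟨ha'.le, h.le, Or.inr (hb0 (by linarith))⟩)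
        · linarith [h3 h]
      · refine Or.inr (Or.inr ⟨ha'.le, ha.le, ?_, ?_, Or.inl (hθ.inside (abs_lt.2 ⟨ha', ha⟩))⟩)
        · by_contra! h; linarith [h4 h]
        · by_contra! h; linarith [h1 h]
    · rcases lt_trichotomy a₀ κ with h | h | h
      · linarith [h2 h]
      · exact Or.inl ⟨ha.ge, h.ge, Or.inr (hb0 (by linarith))⟩
      · linarith [h1 h]
    · refine Or.inl ⟨ha.le, ?_, Or.inl (hθ.outside (lt_abs.2 (Or.inl ha)))⟩
      by_contra! h; linarith [h2 h]
  clear_value b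
  unfold softThr
  rcases hcases with ⟨ha, ha₀, h | h⟩ | ⟨ha, ha₀, h | h⟩ | ⟨ha, ha', ha₀, ha₀', h | h⟩ <;>
    rcases hb with hb | hb <;> subst h <;> split_ifs <;> linarith

end Soft

/-! ### The proximal mapping of the `L₁` norm -/

section L1

variable {p : ℕ} {κ : ℝ}

lemma isProxPoint_l1Norm (hκ : 0 ≤ κ) (z : Vec p) :
    IsProxPoint (fun u : Vec p => κ * l1Norm u) z
      (WithLp.toLp 2 fun j => softThr κ (z j)) := by
  intro u
  simp only [l1Norm, Finset.mul_sum, EuclideanSpace.inner_eq_star_dotProduct, dotProduct,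
    star_trivial, ← Finset.sum_add_distrib]
  refine Finset.sum_le_sum fun j _ => ?_
  have := softThr_subgradient hκ (z j) (u j)
  simp only [PiLp.sub_apply]
  linarith

lemma prox_l1Norm (hκ : 0 ≤ κ) : prox (fun u : Vec p => κ * l1Norm u) =
    fun z => WithLp.toLp 2 fun j => softThr κ (z j) :=
  funext fun z => (isProxPoint_l1Norm hκ z).prox_eq

/-- The diagonal operators with generalized derivatives of soft thresholding on the diagonal. -/
def softOperators (κ : ℝ) (z : Vec p) : Set (Vec p →L[ℝ] Vec p) :=
  {W | ∀ j, IsSoftSlope κ (z j) (W (EuclideanSpace.single j 1) j) ∧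
    ∀ v, W v j = W (EuclideanSpace.single j 1) j * v j}

lemma convex_softOperators (z : Vec p) : Convex ℝ (softOperators κ z) := by
  intro W hW W' hW' a b ha hb hab j
  obtain ⟨h1, h2⟩ := hW j
  obtain ⟨h1', h2'⟩ := hW' j
  have happ : ∀ v, (a • W + b • W') v j = a * W v j + b * W' v j := fun v => rfl
  refine ⟨⟨?_, ?_, fun h => ?_, fun h => ?_⟩, fun v => ?_⟩
  · rw [happ]
    have := h1.nonneg
    have := h1'.nonneg
    positivity
  · rw [happ]
    have := mul_le_mul_of_nonneg_left h1.le_one ha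
    have := mul_le_mul_of_nonneg_left h1'.le_one hb
    linarith
  · rw [happ, h1.inside h, h1'.inside h]; ring
  · rw [happ, h1.outside h, h1'.outside h]; linarith
  · rw [happ, happ, h2, h2']; ring

/-- Along a line through `z`, coordinate `j` is a function of `z j + t * v j` alone, so uniqueness
of scalar derivatives makes the Jacobian diagonal. -/
lemma fderiv_prox_l1Norm_mem (hκ : 0 ≤ κ) {z : Vec p}
    (hd : DifferentiableAt ℝ (prox fun u : Vec p => κ * l1Norm u) z) :
    fderiv ℝ (prox fun u : Vec p => κ * l1Norm u) z ∈ softOperators κ z := by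
  rw [prox_l1Norm hκ] at *
  set F : Vec p → Vec p := fun z => WithLp.toLp 2 fun j => softThr κ (z j) with hF
  have hline : ∀ (v : Vec p) (j : Fin p),
      HasDerivAt (fun t : ℝ => softThr κ (z j + t * v j)) (fderiv ℝ F z v j) 0 := by
    intro v j
    have h1 : HasDerivAt (fun t : ℝ => F (z + t • v)) (fderiv ℝ F z v) 0 := by
      have h2 : HasDerivAt (fun t : ℝ => z + t • v) v 0 := by
        simpa using ((hasDerivAt_id (0 : ℝ)).smul_const v).const_add z
      have h3 : HasFDerivAt F (fderiv ℝ F z) (z + (0 : ℝ) • v) := by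
        simpa using hd.hasFDerivAt
      exact h3.comp_hasDerivAt _ h2
    exact (EuclideanSpace.proj j : Vec p →L[ℝ] ℝ).hasFDerivAt.comp_hasDerivAt 0 h1
  intro j
  have hs : HasDerivAt (softThr κ) (fderiv ℝ F z (EuclideanSpace.single j 1) j) (z j) := by
    have h1 := hline (EuclideanSpace.single j 1) j
    have h2 : HasDerivAt (fun s : ℝ => s - z j) 1 (z j) := (hasDerivAt_id _).sub_const _
    have h3 := HasDerivAt.comp_of_eq (z j) h1 h2 (sub_self _).symm
    simpa [Function.comp_def] using h3
  have hmem := hasDerivAt_softThr_mem_Icc hκ hs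
  refine ⟨⟨hmem.1, hmem.2, fun h => hs.unique (hasDerivAt_softThr_of_lt h),
    fun h => hs.unique (hasDerivAt_softThr_of_gt hκ h)⟩, fun v => ?_⟩
  have h2 : HasDerivAt (fun t : ℝ => z j + t * v j) (v j) 0 := by
    simpa using ((hasDerivAt_id (0 : ℝ)).mul_const (v j)).const_add (z j)
  have h3 : HasDerivAt (softThr κ) (fderiv ℝ F z (EuclideanSpace.single j 1) j)
      (z j + 0 * v j) := by simpa using hs
  have h4 := HasDerivAt.comp (0 : ℝ) h3 h2
  exact (hline v j).unique h4

lemma bouligandJacobian_prox_l1Norm_subset (hκ : 0 ≤ κ) (z : Vec p) :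
    bouligandJacobian (prox fun u : Vec p => κ * l1Norm u) z ⊆ softOperators κ z := by
  rintro V ⟨w, hw, hwz, hV⟩ j
  have hmem := fun i => fderiv_prox_l1Norm_mem hκ (hw i)
  have hlim : ∀ v, Tendsto (fun i => fderiv ℝ (prox fun u : Vec p => κ * l1Norm u) (w i) v j)
      atTop (𝓝 (V v j)) := fun v =>
    ((PiLp.continuous_apply 2 _ j).tendsto _).comp
      (((ContinuousLinearMap.apply ℝ (Vec p) v).continuous.tendsto V).comp hV)
  have hwj : Tendsto (fun i => |w i j|) atTop (𝓝 |z j|) :=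
    (continuous_abs.tendsto _).comp (((PiLp.continuous_apply 2 _ j).tendsto _).comp hwz)
  refine ⟨⟨ge_of_tendsto' (hlim _) fun i => (hmem i j).1.nonneg,
    le_of_tendsto' (hlim _) fun i => (hmem i j).1.le_one, fun h => ?_, fun h => ?_⟩, fun v => ?_⟩
  · refine tendsto_nhds_unique (hlim _) (tendsto_const_nhds.congr' ?_)
    filter_upwards [hwj.eventually_lt_const h] with i hi using ((hmem i j).1.inside hi).symm
  · refine tendsto_nhds_unique (hlim _) (tendsto_const_nhds.congr' ?_)
    filter_upwards [hwj.eventually_const_lt h] with i hi using ((hmem i j).1.outside hi).symm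
  · refine tendsto_nhds_unique (hlim v) (((hlim _).mul_const (v j)).congr fun i => ?_)
    exact ((hmem i j).2 v).symm

/-- Elements of Clarke's generalized Jacobian of the proximal mapping of `κ ‖·‖₁` are diagonal. -/
lemma exists_slopes_of_mem_clarkeJacobian (hκ : 0 ≤ κ) {z : Vec p}
    {V : Matrix (Fin p) (Fin p) ℝ}
    (hV : V ∈ clarkeJacobian (prox fun u : Vec p => κ * l1Norm u) z) :
    ∃ θ : Fin p → ℝ, (∀ j, IsSoftSlope κ (z j) (θ j)) ∧ ∀ v j, act V v j = θ j * v j := by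
  have h := convexHull_min (bouligandJacobian_prox_l1Norm_subset hκ z) (convex_softOperators z) hV
  exact ⟨_, fun j => (h j).1, fun v j => (h j).2 v⟩

lemma hasFDerivAt_prox_l1Norm (hκ : 0 ≤ κ) {z : Vec p} {θ : Fin p → ℝ}
    (h : ∀ j, HasDerivAt (softThr κ) (θ j) (z j)) :
    HasFDerivAt (prox fun u : Vec p => κ * l1Norm u)
      (LinearMap.toContinuousLinearMap (Matrix.toEuclideanLin (Matrix.diagonal θ))) z := by
  rw [prox_l1Norm hκ, ← hasFDerivWithinAt_univ, hasFDerivWithinAt_euclidean]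
  intro j
  have h1 : HasFDerivAt (fun z : Vec p => z j) (EuclideanSpace.proj j : Vec p →L[ℝ] ℝ) z :=
    (EuclideanSpace.proj j : Vec p →L[ℝ] ℝ).hasFDerivAt
  refine (((h j).comp_hasFDerivAt z h1).congr_fderiv ?_).hasFDerivWithinAt
  ext v
  simp [Matrix.toLpLin_apply, Matrix.mulVec_diagonal]

lemma clarkeJacobian_prox_l1Norm_nonempty (hκ : 0 < κ) (z : Vec p) :
    (clarkeJacobian (prox fun u : Vec p => κ * l1Norm u) z).Nonempty := by
  classical
  set θ : Fin p → ℝ := fun j => if κ ≤ |z j| then 1 else 0 with hθ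
  -- Since `κ > 0`, slight scaling outward pushes coordinates with `|z j| ≥ κ` strictly past the
  -- kink and leaves the others inside; there the Jacobian is constant.
  have hc : Tendsto (fun ε : ℝ => (1 + ε) • z) (𝓝[>] 0) (𝓝 z) := by
    have h1 : Continuous fun ε : ℝ => (1 + ε) • z := by fun_prop
    have h2 := (h1.tendsto 0).mono_left (nhdsWithin_le_nhds (s := Ioi (0 : ℝ)))
    simpa using h2
  have hev : ∀ᶠ ε : ℝ in 𝓝[>] 0, ∀ j, HasDerivAt (softThr κ) (θ j) (((1 + ε) • z) j) := by
    rw [eventually_all]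
    intro j
    by_cases hj : κ ≤ |z j|
    · filter_upwards [self_mem_nhdsWithin] with ε hε
      have hε' : (0 : ℝ) < ε := hε
      simp only [hθ, if_pos hj]
      refine hasDerivAt_softThr_of_gt hκ.le ?_
      rw [PiLp.smul_apply, smul_eq_mul, abs_mul, abs_of_pos (by linarith)]
      nlinarith
    · simp only [hθ, if_neg hj]
      have hcj : Tendsto (fun ε : ℝ => |((1 + ε) • z) j|) (𝓝[>] 0) (𝓝 |z j|) :=
        (continuous_abs.tendsto _).comp (((PiLp.continuous_apply 2 _ j).tendsto _).comp hc)
      filter_upwards [hcj.eventually_lt_const (not_le.1 hj)] with ε hε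
      exact hasDerivAt_softThr_of_lt hε
  obtain ⟨ε, hε, hεd⟩ := exists_seq_forall_of_frequently hev.frequently
  have hF := fun i => hasFDerivAt_prox_l1Norm hκ.le (hεd i)
  refine ⟨Matrix.diagonal θ, subset_convexHull ℝ _ ⟨fun i => (1 + ε i) • z,
    fun i => (hF i).differentiableAt, hc.comp hε, ?_⟩⟩
  simp only [(hF _).fderiv]
  exact tendsto_const_nhds

/-- Near `z₀` soft thresholding is affine on segments from `z₀`, with every element of the
generalized Jacobian as slope. -/
lemma eventually_prox_l1Norm_segment (hκ : 0 < κ) (z₀ : Vec p) :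
    ∀ᶠ z in 𝓝 z₀, ∀ V ∈ clarkeJacobian (prox fun u : Vec p => κ * l1Norm u) z,
      ∀ t ∈ Icc (0 : ℝ) 1, prox (fun u : Vec p => κ * l1Norm u) (z₀ + t • (z - z₀)) =
        prox (fun u : Vec p => κ * l1Norm u) z₀ + t • act V (z - z₀) := by
  have hev : ∀ᶠ z in 𝓝 z₀, ∀ j, ∀ θ, IsSoftSlope κ (z j) θ → ∀ t ∈ Icc (0 : ℝ) 1,
      softThr κ (z₀ j + t * (z j - z₀ j)) = softThr κ (z₀ j) + t * (θ * (z j - z₀ j)) :=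
    eventually_all.2 fun j =>
      ((PiLp.continuous_apply 2 _ j).tendsto z₀).eventually (eventually_softThr_segment hκ (z₀ j))
  filter_upwards [hev] with z hz V hV t ht
  obtain ⟨θ, hθ, hact⟩ := exists_slopes_of_mem_clarkeJacobian hκ.le hV
  rw [prox_l1Norm hκ.le]
  ext j
  have := hz j (θ j) (hθ j) t ht
  simpa [hact, mul_sub] using this

end L1

/-! ### Strongly convex functions with a quadratic upper bound -/

section QuadBounds

variable {p : ℕ} {φ : Vec p → ℝ} {g : Vec p → Vec p} {m L : ℝ}

/-- `φ` lies between its linearizations with slopes `g` plus `m/2 ‖·‖²` and `L/2 ‖·‖²`. -/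
structure QuadBounds (φ : Vec p → ℝ) (g : Vec p → Vec p) (m L : ℝ) : Prop where
  lower : ∀ x x', φ x + ⟪g x, x' - x⟫_ℝ + m / 2 * ‖x' - x‖ ^ 2 ≤ φ x'
  upper : ∀ x x', φ x' ≤ φ x + ⟪g x, x' - x⟫_ℝ + L / 2 * ‖x' - x‖ ^ 2

lemma QuadBounds.hasGradientAt (h : QuadBounds φ g m L) (hm : 0 < m) (x : Vec p) :
    HasGradientAt φ (g x) x :=
  hasGradientAt_of_bounds (fun x' => by
    have := h.lower x x'
    have : 0 ≤ m / 2 * ‖x' - x‖ ^ 2 := by positivity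
    linarith) (h.upper x)

lemma QuadBounds.differentiable (h : QuadBounds φ g m L) (hm : 0 < m) : Differentiable ℝ φ :=
  fun x => (h.hasGradientAt hm x).differentiableAt

lemma QuadBounds.le_gap (h : QuadBounds φ g m L) {xs : Vec p} (hxs : g xs = 0) (x : Vec p) :
    m / 2 * ‖x - xs‖ ^ 2 ≤ φ x - φ xs := by
  have := h.lower xs x
  rw [hxs, inner_zero_left] at this
  linarith

lemma QuadBounds.gap_le (h : QuadBounds φ g m L) {xs : Vec p} (hxs : g xs = 0) (x : Vec p) :
    φ x - φ xs ≤ L / 2 * ‖x - xs‖ ^ 2 := by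
  have := h.upper xs x
  rw [hxs, inner_zero_left] at this
  linarith

lemma QuadBounds.gap_nonneg (h : QuadBounds φ g m L) (hm : 0 < m) {xs : Vec p} (hxs : g xs = 0)
    (x : Vec p) : 0 ≤ φ x - φ xs :=
  (by positivity : 0 ≤ m / 2 * ‖x - xs‖ ^ 2).trans (h.le_gap hxs x)

lemma QuadBounds.norm_sq_le_gap (h : QuadBounds φ g m L) (hm : 0 < m) (hL : 0 < L) {xs : Vec p}
    (hxs : g xs = 0) (x : Vec p) : ‖g x‖ ^ 2 ≤ 2 * L * (φ x - φ xs) := by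
  -- This gradient step minimizes the upper quadratic model.
  have h1 := h.upper x (x - (1 / L) • g x)
  have h2 := h.gap_nonneg hm hxs (x - (1 / L) • g x)
  rw [sub_sub_cancel_left, inner_neg_right, inner_smul_right, norm_neg, norm_smul, mul_pow,
    real_inner_self_eq_norm_sq, Real.norm_eq_abs, sq_abs] at h1
  have h3 : -(1 / L * ‖g x‖ ^ 2) + L / 2 * ((1 / L) ^ 2 * ‖g x‖ ^ 2) = -(‖g x‖ ^ 2 / (2 * L)) := by
    field_simp; ring
  have h4 : ‖g x‖ ^ 2 / (2 * L) ≤ φ x - φ xs := by linarith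
  rw [div_le_iff₀ (by positivity)] at h4
  linarith

lemma QuadBounds.norm_grad_le (h : QuadBounds φ g m L) (hm : 0 < m) (hL : 0 < L) {xs : Vec p}
    (hxs : g xs = 0) (x : Vec p) : ‖g x‖ ≤ L * ‖x - xs‖ := by
  refine (sq_le_sq₀ (norm_nonneg _) (by positivity)).1 ?_
  have h1 := h.norm_sq_le_gap hm hL hxs x
  have h2 := mul_le_mul_of_nonneg_left (h.gap_le hxs x) (by positivity : 0 ≤ 2 * L)
  calc _ ≤ _ := h1.trans h2
    _ = _ := by ring

/-- The Polyak-Łojasiewicz inequality, by completing the square in the lower bound. -/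
lemma QuadBounds.gap_le_norm_sq (h : QuadBounds φ g m L) (hm : 0 < m) (xs x : Vec p) :
    2 * m * (φ x - φ xs) ≤ ‖g x‖ ^ 2 := by
  have h1 := h.lower x xs
  have h2 := norm_add_sq_real (g x) (m • (xs - x))
  rw [norm_smul, inner_smul_right, mul_pow, Real.norm_eq_abs, sq_abs] at h2
  have h3 := sq_nonneg ‖g x + m • (xs - x)‖
  nlinarith

lemma QuadBounds.existsUnique_zero (h : QuadBounds φ g m L) (hm : 0 < m) :
    ∃! xs, g xs = 0 := by
  have hcoer : Tendsto φ (cocompact (Vec p)) atTop := by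
    have h1 : Tendsto (fun r : ℝ => φ 0 + r * (m / 2 * r - ‖g 0‖)) atTop atTop := by
      refine tendsto_atTop_add_const_left _ _ (tendsto_id.atTop_mul_atTop₀ ?_)
      exact tendsto_atTop_add_const_right _ _ (tendsto_id.const_mul_atTop (by positivity))
    refine tendsto_atTop_mono (fun x => ?_) (h1.comp (tendsto_norm_cocompact_atTop (E := Vec p)))
    have h2 := h.lower 0 x
    have h3 := neg_le_of_abs_le (abs_real_inner_le_norm (g 0) x)
    simp only [sub_zero] at h2
    simp only [Function.comp_apply]
    linarith
  obtain ⟨xs, hxs⟩ := (h.differentiable hm).continuous.exists_forall_le hcoer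
  have hg : g xs = 0 := by
    have h1 : IsLocalMin φ xs := Eventually.of_forall hxs
    have h2 := h1.hasFDerivAt_eq_zero (h.hasGradientAt hm xs).hasFDerivAt
    simpa using h2
  refine ⟨xs, hg, fun y hy => ?_⟩
  have h1 := h.le_gap hg y
  have h2 := h.le_gap hy xs
  rw [norm_sub_rev xs y] at h2
  have h3 : m * ‖y - xs‖ ^ 2 ≤ 0 := by linarith
  have h4 : ‖y - xs‖ ^ 2 ≤ 0 := nonpos_of_mul_nonpos_right h3 hm
  have h5 : ‖y - xs‖ = 0 := by nlinarith [norm_nonneg (y - xs)]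
  exact sub_eq_zero.1 (norm_eq_zero.1 h5)

/-- Sufficiently short steps in a direction of strong descent satisfy the Armijo condition. -/
lemma QuadBounds.armijo (h : QuadBounds φ g m L) {x d : Vec p} {mu t : ℝ}
    (hmu : mu < 1) (ht : 0 ≤ t) (hd : m / 2 * ‖d‖ ^ 2 ≤ -⟪g x, d⟫_ℝ)
    (htL : L * t ≤ (1 - mu) * m) : φ (x + t • d) ≤ φ x + mu * t * ⟪g x, d⟫_ℝ := by
  have h1 := h.upper x (x + t • d)
  rw [add_sub_cancel_left, inner_smul_right, norm_smul, mul_pow, Real.norm_eq_abs, sq_abs] at h1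
  have h2 := mul_le_mul_of_nonneg_right htL (by positivity : 0 ≤ t * ‖d‖ ^ 2)
  have h3 := mul_le_mul_of_nonneg_left hd (mul_nonneg (sub_nonneg.2 hmu.le) ht)
  nlinarith

/-- If the gradient is linear on the segment from a critical point to `x`, then `φ` is quadratic
there. -/
lemma QuadBounds.gap_eq_half_inner (h : QuadBounds φ g m L) (hm : 0 < m) {xs x w : Vec p}
    (hlin : ∀ t ∈ Icc (0 : ℝ) 1, g (xs + t • (x - xs)) = t • w) :
    φ x - φ xs = 1 / 2 * ⟪w, x - xs⟫_ℝ := by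
  set e := x - xs with he
  set f : ℝ → ℝ := fun t => φ (xs + t • e) - t ^ 2 * (1 / 2 * ⟪w, e⟫_ℝ) with hf
  have hder : ∀ t : ℝ, HasDerivAt f (⟪g (xs + t • e), e⟫_ℝ - t * ⟪w, e⟫_ℝ) t := by
    intro t
    have h1 : HasDerivAt (fun t : ℝ => xs + t • e) e t := by
      simpa using ((hasDerivAt_id t).smul_const e).const_add xs
    have h2 := (h.hasGradientAt hm (xs + t • e)).hasFDerivAt.comp_hasDerivAt t h1
    rw [InnerProductSpace.toDual_apply_apply] at h2
    have h3 := (hasDerivAt_pow 2 t).mul_const (1 / 2 * ⟪w, e⟫_ℝ)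
    refine (h2.sub h3).congr_deriv ?_
    norm_num
    ring
  have hconst := constant_of_has_deriv_right_zero (f := f) (a := 0) (b := 1)
    (fun t _ => (hder t).continuousAt.continuousWithinAt)
    (fun t ht => by
      have h1 := hder t
      rw [hlin t ⟨ht.1, ht.2.le⟩, real_inner_smul_left, sub_self] at h1
      exact h1.hasDerivWithinAt) 1 (right_mem_Icc.2 zero_le_one)
  have hx : xs + e = x := by rw [he]; abel
  simp only [hf, one_smul, zero_smul, add_zero, hx] at hconst
  linarith

end QuadBounds

/-! ### The objective and its generalized Hessian -/

namespace Subproblem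

variable {n p : ℕ} (S : Subproblem n p)

/-- The gradient of `φ`. -/
noncomputable def grad (x : Vec p) : Vec p :=
  S.rho • (act S.Aᵀ (prox S.scaledLoss (S.f1 x) - S.f1 x) + (S.f2 x - prox S.scaledL1 (S.f2 x)))
    + (1 / S.sig) • (x - S.xk)

/-- The upper curvature bound `ρ (a² + 1) + σ⁻¹`, where `a` bounds the norm of `A`. -/
noncomputable def curv (a : ℝ) : ℝ := S.rho * (a ^ 2 + 1) + 1 / S.sig

variable {S}

lemma f1_sub (x x' : Vec p) : S.f1 x' - S.f1 x = -act S.A (x' - x) := by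
  simp only [f1, act_sub]; abel

lemma f2_sub (x x' : Vec p) : S.f2 x' - S.f2 x = x' - x := by
  simp only [f2]; abel

lemma isProxPoint_scaledLoss (hrho : 0 < S.rho) (y : Vec n) :
    IsProxPoint S.scaledLoss y (prox S.scaledLoss y) :=
  isProxPoint_prox_rankLoss (by positivity) y

lemma isProxPoint_scaledL1 (hlam : 0 < S.lam) (hrho : 0 < S.rho) (z : Vec p) :
    IsProxPoint S.scaledL1 z (prox S.scaledL1 z) := by
  have h := isProxPoint_l1Norm (κ := S.lam / S.rho) (by positivity) z
  have h2 := h.prox_eq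
  change prox S.scaledL1 z = _ at h2
  rw [h2]
  exact h

lemma inner_grad (x v : Vec p) : ⟪S.grad x, v⟫_ℝ =
    S.rho * (⟪S.f1 x - prox S.scaledLoss (S.f1 x), -act S.A v⟫_ℝ +
      ⟪S.f2 x - prox S.scaledL1 (S.f2 x), v⟫_ℝ) + 1 / S.sig * ⟪x - S.xk, v⟫_ℝ := by
  simp only [grad, inner_add_left, real_inner_smul_left, inner_act_transpose]
  rw [← neg_sub (S.f1 x), inner_neg_left, inner_neg_right]

lemma quadBounds_phi (hlam : 0 < S.lam) (hsig : 0 < S.sig) (hrho : 0 < S.rho) {a : ℝ}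
    (ha : ∀ v, ‖act S.A v‖ ≤ a * ‖v‖) :
    QuadBounds S.phi S.grad (1 / S.sig) (S.curv a) := by
  have hquad : ∀ x x' : Vec p, 1 / (2 * S.sig) * ‖x' - S.xk‖ ^ 2 =
      1 / (2 * S.sig) * ‖x - S.xk‖ ^ 2 + 1 / S.sig * ⟪x - S.xk, x' - x⟫_ℝ
        + 1 / S.sig / 2 * ‖x' - x‖ ^ 2 := by
    intro x x'
    have : x' - S.xk = (x - S.xk) + (x' - x) := by abel
    rw [this, norm_add_sq_real]
    field_simp
  refine ⟨fun x x' => ?_, fun x x' => ?_⟩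
  · have h1 := moreau_lower (isProxPoint_scaledLoss hrho) (S.f1 x) (S.f1 x')
    have h2 := moreau_lower (isProxPoint_scaledL1 hlam hrho) (S.f2 x) (S.f2 x')
    rw [f1_sub] at h1
    rw [f2_sub] at h2
    have h3 := mul_le_mul_of_nonneg_left (add_le_add h1 h2) hrho.le
    rw [inner_grad, phi, phi, hquad x x']
    linarith
  · have h1 := moreau_upper (isProxPoint_scaledLoss hrho) (S.f1 x) (S.f1 x')
    have h2 := moreau_upper (isProxPoint_scaledL1 hlam hrho) (S.f2 x) (S.f2 x')
    rw [f1_sub, norm_neg] at h1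
    rw [f2_sub] at h2
    have h3 : ‖act S.A (x' - x)‖ ^ 2 ≤ (a * ‖x' - x‖) ^ 2 := by
      gcongr; exact ha _
    have h4 : moreau S.scaledLoss (S.f1 x') + moreau S.scaledL1 (S.f2 x') ≤ _ :=
      (add_le_add h1 h2).trans (b := _) (c := moreau S.scaledLoss (S.f1 x)
        + ⟪S.f1 x - prox S.scaledLoss (S.f1 x), -act S.A (x' - x)⟫_ℝ
        + 1 / 2 * (a * ‖x' - x‖) ^ 2 + (moreau S.scaledL1 (S.f2 x)
        + ⟪S.f2 x - prox S.scaledL1 (S.f2 x), x' - x⟫_ℝ + 1 / 2 * ‖x' - x‖ ^ 2)) (by linarith)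
    have h5 := mul_le_mul_of_nonneg_left h4 hrho.le
    rw [inner_grad, phi, phi, hquad x x', curv]
    linarith

lemma act_hessian (V₁ : Matrix (Fin n) (Fin n) ℝ) (V₂ : Matrix (Fin p) (Fin p) ℝ) (v : Vec p) :
    act (S.rho • (S.Aᵀ * (1 - V₁) * S.A + 1 - V₂)
      + (1 / S.sig) • (1 : Matrix (Fin p) (Fin p) ℝ)) v =
    S.rho • (act S.Aᵀ (act (1 - V₁) (act S.A v)) + (v - act V₂ v)) + (1 / S.sig) • v := by
  rw [act_add_left, act_smul_left, act_smul_left, act_one, act_sub_left, act_add_left, act_one,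
    act_mul, act_mul, add_sub_assoc]

lemma symmBounds_of_mem_genHessian (hlam : 0 < S.lam) (hrho : 0 < S.rho)
    {a : ℝ} (ha : ∀ v, ‖act S.A v‖ ≤ a * ‖v‖) {x : Vec p} {H : Matrix (Fin p) (Fin p) ℝ}
    (hH : H ∈ S.genHessian x) : SymmBounds H (1 / S.sig) (S.curv a) := by
  obtain ⟨V₁, hV₁, V₂, hV₂, rfl⟩ := hH
  have hE := isOrthProjector_one_sub_of_mem_rankJacobian hV₁
  obtain ⟨θ, hθ, hact⟩ := exists_slopes_of_mem_clarkeJacobian (κ := S.lam / S.rho)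
    (by positivity) hV₂
  have hV2 : ∀ u v : Vec p, ⟪u, act V₂ v⟫_ℝ = ∑ j, θ j * (u j * v j) := fun u v => by
    simp only [EuclideanSpace.inner_eq_star_dotProduct, dotProduct, star_trivial, hact]
    exact Finset.sum_congr rfl fun j _ => by ring
  have hlow : ∀ v : Vec p, 0 ≤ ⟪v, act V₂ v⟫_ℝ := fun v => by
    rw [hV2]
    exact Finset.sum_nonneg fun j _ => mul_nonneg (hθ j).nonneg (mul_self_nonneg _)
  have hup : ∀ v : Vec p, ⟪v, act V₂ v⟫_ℝ ≤ ‖v‖ ^ 2 := fun v => by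
    rw [hV2, ← real_inner_self_eq_norm_sq]
    simp only [EuclideanSpace.inner_eq_star_dotProduct, dotProduct, star_trivial]
    exact Finset.sum_le_sum fun j _ => mul_le_of_le_one_left (mul_self_nonneg _) (hθ j).le_one
  have hself : ∀ v : Vec p, ⟪v, act (S.rho • (S.Aᵀ * (1 - V₁) * S.A + 1 - V₂)
      + (1 / S.sig) • (1 : Matrix (Fin p) (Fin p) ℝ)) v⟫_ℝ =
      S.rho * (‖act (1 - V₁) (act S.A v)‖ ^ 2 + (‖v‖ ^ 2 - ⟪v, act V₂ v⟫_ℝ))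
        + 1 / S.sig * ‖v‖ ^ 2 := fun v => by
    rw [act_hessian]
    simp only [inner_add_right, inner_sub_right, inner_smul_right]
    rw [real_inner_comm (act S.Aᵀ _) v, inner_act_transpose, real_inner_comm, hE.inner_act,
      real_inner_self_eq_norm_sq]
  refine ⟨fun u v => ?_, fun v => ?_, fun v => ?_⟩
  · rw [act_hessian, act_hessian]
    simp only [inner_add_right, inner_sub_right, inner_smul_right, inner_add_left, inner_sub_left,
      real_inner_smul_left]
    have h1 : ⟪u, act S.Aᵀ (act (1 - V₁) (act S.A v))⟫_ℝ =
        ⟪act S.Aᵀ (act (1 - V₁) (act S.A u)), v⟫_ℝ := by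
      rw [real_inner_comm, inner_act_transpose, inner_act_transpose, real_inner_comm,
        ← inner_act_transpose, hE.symm]
    have h2 : ⟪act V₂ u, v⟫_ℝ = ⟪u, act V₂ v⟫_ℝ := by
      rw [real_inner_comm, hV2, hV2]
      exact Finset.sum_congr rfl fun j _ => by ring
    rw [h1, h2]
  · rw [hself]
    have h1 := hup v
    have h2 : 0 ≤ S.rho * (‖act (1 - V₁) (act S.A v)‖ ^ 2 + (‖v‖ ^ 2 - ⟪v, act V₂ v⟫_ℝ)) :=
      mul_nonneg hrho.le (by have := sq_nonneg ‖act (1 - V₁) (act S.A v)‖; linarith)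
    linarith
  · rw [hself, curv]
    have h1 := hlow v
    have h2 : ‖act (1 - V₁) (act S.A v)‖ ^ 2 ≤ (a * ‖v‖) ^ 2 := by
      gcongr; exact (hE.norm_act_le _).trans (ha v)
    have h3 : S.rho * (‖act (1 - V₁) (act S.A v)‖ ^ 2 + (‖v‖ ^ 2 - ⟪v, act V₂ v⟫_ℝ)) ≤
        S.rho * ((a * ‖v‖) ^ 2 + ‖v‖ ^ 2) := by
      gcongr; linarith
    linarith

lemma genHessian_nonempty (hlam : 0 < S.lam) (hrho : 0 < S.rho) (x : Vec p) :
    (S.genHessian x).Nonempty := by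
  obtain ⟨V₁, hV₁⟩ := rankJacobian_nonempty (1 / S.rho) (S.f1 x)
  obtain ⟨V₂, hV₂⟩ := clarkeJacobian_prox_l1Norm_nonempty (κ := S.lam / S.rho) (by positivity)
    (S.f2 x)
  exact ⟨_, V₁, hV₁, V₂, hV₂, rfl⟩

/-- Near `x₀` the gradient is affine on segments from `x₀`, with every element of the generalized
Hessian as slope. -/
lemma eventually_grad_segment (hlam : 0 < S.lam) (hrho : 0 < S.rho) (x₀ : Vec p) :
    ∀ᶠ x in 𝓝 x₀, ∀ H ∈ S.genHessian x, ∀ t ∈ Icc (0 : ℝ) 1,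
      S.grad (x₀ + t • (x - x₀)) = S.grad x₀ + t • act H (x - x₀) := by
  have hc1 : Continuous S.f1 :=
    (continuous_const.sub (continuous_act S.A)).add continuous_const
  have hc2 : Continuous S.f2 := continuous_id.add continuous_const
  have h1 := (hc1.tendsto x₀).eventually
    (eventually_prox_rankLoss_segment (tau := 1 / S.rho) (by positivity) (S.f1 x₀))
  have h2 := (hc2.tendsto x₀).eventually
    (eventually_prox_l1Norm_segment (κ := S.lam / S.rho) (by positivity) (S.f2 x₀))
  filter_upwards [h1, h2] with x h1 h2
  rintro H ⟨V₁, hV₁, V₂, hV₂, rfl⟩ t ht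
  have e1 : S.f1 (x₀ + t • (x - x₀)) = S.f1 x₀ + t • (S.f1 x - S.f1 x₀) := by
    rw [f1_sub, f1, f1, act_add, act_smul]; module
  have e2 : S.f2 (x₀ + t • (x - x₀)) = S.f2 x₀ + t • (S.f2 x - S.f2 x₀) := by
    rw [f2_sub, f2, f2]; module
  have p1 : prox S.scaledLoss (S.f1 x₀ + t • (S.f1 x - S.f1 x₀)) = _ := h1 V₁ hV₁ t ht
  have p2 : prox S.scaledL1 (S.f2 x₀ + t • (S.f2 x - S.f2 x₀)) = _ := h2 V₂ hV₂ t ht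
  change _ = prox S.scaledLoss (S.f1 x₀) + _ at p1
  change _ = prox S.scaledL1 (S.f2 x₀) + _ at p2
  rw [grad, grad, e1, e2, p1, p2, act_hessian, act_sub_left, act_one, f1_sub, f2_sub]
  generalize x - x₀ = e
  have hneg : act V₁ (-act S.A e) = -act V₁ (act S.A e) := map_neg _ _
  rw [hneg]
  simp only [act_add, act_sub, smul_neg]
  have hneg' : ∀ w : Vec n, act S.Aᵀ (-w) = -act S.Aᵀ w := fun w => map_neg _ _
  simp only [hneg', act_smul]
  module

end Subproblem

/-! ### Convergence of the method -/

section Method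

variable {n p : ℕ} {S : Subproblem n p} {N : SSNParams} {g : Vec p → Vec p} {m L : ℝ}

lemma exists_isNewtonDirection (hN : N.Valid) {H : Matrix (Fin p) (Fin p) ℝ}
    (hH : SymmBounds H m L) (hm : 0 < m) (hL : 0 < L) (x : Vec p) :
    ∃ d, IsNewtonDirection S N x H d := by
  have h0 := hN.eta0_pos
  have h1 := hN.eta1_pos
  -- At a critical point the right-hand side is zero and conjugate gradients stay at `0`.
  by_cases hg : ∇ S.phi x = 0
  · refine ⟨_, ⟨1, le_rfl, rfl⟩, ?_⟩
    simp [hg, cgIterate, cgStep]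
  · have hpos : 0 < ‖∇ S.phi x‖ := norm_pos_iff.2 hg
    obtain ⟨k, hk, hle⟩ := exists_cgIterate_residual_le (c := -∇ S.phi x) hH hm hL
      (ε := min N.eta0 (N.eta1 * ‖∇ S.phi x‖) * ‖∇ S.phi x‖) (by positivity)
    rw [sub_neg_eq_add] at hle
    exact ⟨_, ⟨k, hk, rfl⟩, hle⟩

lemma IsNewtonDirection.descent {x d : Vec p} {H : Matrix (Fin p) (Fin p) ℝ}
    (hd : IsNewtonDirection S N x H d) (hH : SymmBounds H m L) (hm : 0 < m) (hL : 0 < L) :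
    ‖∇ S.phi x‖ ^ 2 / (2 * L) + m / 2 * ‖d‖ ^ 2 ≤ -⟪∇ S.phi x, d⟫_ℝ := by
  obtain ⟨⟨k, hk, rfl⟩, -⟩ := hd
  have := inner_cgIterate_ge (c := -∇ S.phi x) hH hm hL hk
  rwa [norm_neg, inner_neg_left] at this

lemma armijo_of_small (hφ : QuadBounds S.phi g m L) (hm : 0 < m) (hL : 0 < L) (hN : N.Valid)
    {x d : Vec p} {H : Matrix (Fin p) (Fin p) ℝ}
    (hd : IsNewtonDirection S N x H d) (hH : SymmBounds H m L) {k : ℕ}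
    (hk : L * N.del ^ k ≤ (1 - N.mu) * m) : Armijo S N x d k := by
  have h1 := hd.descent hH hm hL
  rw [(hφ.hasGradientAt hm x).gradient] at h1
  have h2 : 0 ≤ ‖g x‖ ^ 2 / (2 * L) := by positivity
  have := hN.mu_lt
  have := hN.del_pos
  rw [Armijo, (hφ.hasGradientAt hm x).gradient]
  exact hφ.armijo (by linarith) (by positivity) (by linarith) hk

lemma exists_armijo (hφ : QuadBounds S.phi g m L) (hm : 0 < m) (hL : 0 < L) (hN : N.Valid)
    {x d : Vec p} {H : Matrix (Fin p) (Fin p) ℝ}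
    (hd : IsNewtonDirection S N x H d) (hH : SymmBounds H m L) : ∃ k : ℕ, Armijo S N x d k := by
  have h1 : 0 < 1 - N.mu := by have := hN.mu_lt; linarith
  obtain ⟨k, hk⟩ := exists_pow_lt_of_lt_one (by positivity : 0 < (1 - N.mu) * m / L) hN.del_lt
  rw [lt_div_iff₀ hL] at hk
  exact ⟨k, armijo_of_small hφ hm hL hN hd hH (by linarith)⟩

/-- The least step size accepted by the line search is bounded away from zero. -/
lemma min_le_step (hφ : QuadBounds S.phi g m L) (hm : 0 < m) (hL : 0 < L) (hN : N.Valid)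
    {x d : Vec p} {H : Matrix (Fin p) (Fin p) ℝ}
    (hd : IsNewtonDirection S N x H d) (hH : SymmBounds H m L) {k : ℕ}
    (hk : IsLeast {k | Armijo S N x d k} k) :
    min 1 (N.del * ((1 - N.mu) * m / L)) ≤ N.del ^ k := by
  rcases k with _ | k
  · simp
  · refine (min_le_right _ _).trans ?_
    rw [pow_succ']
    refine mul_le_mul_of_nonneg_left ?_ hN.del_pos.le
    -- Otherwise the preceding trial step would already be short enough to be accepted.
    by_contra! hlt
    rw [lt_div_iff₀ hL] at hlt
    have := hk.2 (armijo_of_small hφ hm hL hN hd hH (k := k) (by linarith))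
    omega

/-- The method decreases the gap `φ(x) - φ(x*)` at a linear rate. -/
lemma exists_gap_contraction (hφ : QuadBounds S.phi g m L) (hm : 0 < m) (hL : 0 < L)
    (hN : N.Valid) (hS : ∀ x, ∀ H ∈ S.genHessian x, SymmBounds H m L) {xs : Vec p}
    (hxs : g xs = 0) : ∃ θ : ℝ, 0 < θ ∧ ∀ x x', SSNStep S N x x' →
      S.phi x' - S.phi xs ≤ (1 - θ) * (S.phi x - S.phi xs) := by
  have hmu := hN.mu_pos
  have hdel := hN.del_pos
  have h1 : 0 < 1 - N.mu := by have := hN.mu_lt; linarith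
  set τ := min 1 (N.del * ((1 - N.mu) * m / L)) with hτ
  have hτ0 : 0 < τ := by positivity
  refine ⟨N.mu * τ * (m / L), by positivity, ?_⟩
  rintro x x' ⟨H, hH, d, hd, k, hk, rfl⟩
  have hstep := min_le_step hφ hm hL hN hd (hS x H hH) hk
  have hdesc := hd.descent (hS x H hH) hm hL
  have harm : S.phi (x + N.del ^ k • d) ≤ S.phi x + N.mu * N.del ^ k * ⟪∇ S.phi x, d⟫_ℝ := hk.1
  rw [(hφ.hasGradientAt hm x).gradient] at hdesc harm
  have hgap := hφ.gap_le_norm_sq hm xs x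
  have h2 : m / L * (S.phi x - S.phi xs) ≤ -⟪g x, d⟫_ℝ := by
    have h3 : m / L * (S.phi x - S.phi xs) ≤ ‖g x‖ ^ 2 / (2 * L) := by
      rw [le_div_iff₀ (by positivity)]
      calc _ = 2 * m * (S.phi x - S.phi xs) := by field_simp
        _ ≤ _ := hgap
    have : 0 ≤ m / 2 * ‖d‖ ^ 2 := by positivity
    linarith
  have hg0 := hφ.gap_nonneg hm hxs x
  have h4 : τ * (m / L * (S.phi x - S.phi xs)) ≤ N.del ^ k * -⟪g x, d⟫_ℝ := by gcongr
  have h5 := mul_le_mul_of_nonneg_left h4 hmu.le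
  linarith

lemma tendsto_of_isSSNSequence (hφ : QuadBounds S.phi g m L) (hm : 0 < m) (hL : 0 < L)
    (hN : N.Valid) (hS : ∀ x, ∀ H ∈ S.genHessian x, SymmBounds H m L) {xs : Vec p}
    (hxs : g xs = 0) {x : ℕ → Vec p} (hx : IsSSNSequence S N x) : Tendsto x atTop (𝓝 xs) := by
  obtain ⟨θ, hθ, hcon⟩ := exists_gap_contraction hφ hm hL hN hS hxs
  -- Nothing guarantees `θ ≤ 1`, and a nonnegative ratio is needed to iterate.
  set q := max (1 - θ) 0 with hq
  have hq0 : 0 ≤ q := le_max_right _ _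
  have hq1 : q < 1 := max_lt (by linarith) one_pos
  have hgap : ∀ i, S.phi (x i) - S.phi xs ≤ q ^ i * (S.phi (x 0) - S.phi xs) := by
    intro i
    induction i with
    | zero => simp
    | succ i ih =>
      have h0 := hφ.gap_nonneg hm hxs (x i)
      calc _ ≤ (1 - θ) * (S.phi (x i) - S.phi xs) := hcon _ _ (hx i)
        _ ≤ q * (S.phi (x i) - S.phi xs) := by gcongr; exact le_max_left _ _
        _ ≤ q * (q ^ i * (S.phi (x 0) - S.phi xs)) := by gcongr
        _ = _ := by ring
  have hsq : Tendsto (fun i => ‖x i - xs‖ ^ 2) atTop (𝓝 0) := by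
    have hlim : Tendsto (fun i => 2 / m * (q ^ i * (S.phi (x 0) - S.phi xs))) atTop (𝓝 0) := by
      simpa using ((tendsto_pow_atTop_nhds_zero_of_lt_one hq0 hq1).mul_const
        (S.phi (x 0) - S.phi xs)).const_mul (2 / m)
    refine squeeze_zero (fun i => sq_nonneg _) (fun i => ?_) hlim
    have h1 := (hφ.le_gap hxs (x i)).trans (hgap i)
    calc ‖x i - xs‖ ^ 2 = 2 / m * (m / 2 * ‖x i - xs‖ ^ 2) := by field_simp
      _ ≤ _ := by gcongr
  rw [tendsto_iff_norm_sub_tendsto_zero]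
  simpa using hsq.sqrt

/-- Close to the solution the unit step is accepted, and the error is squared. -/
lemma eventually_quadratic_step (hφ : QuadBounds S.phi g m L) (hm : 0 < m) (hL : 0 < L)
    (hN : N.Valid) (hS : ∀ x, ∀ H ∈ S.genHessian x, SymmBounds H m L) {xs : Vec p}
    (hxs : g xs = 0)
    (hloc : ∀ᶠ x in 𝓝 xs, ∀ H ∈ S.genHessian x, ∀ t ∈ Icc (0 : ℝ) 1,
      g (xs + t • (x - xs)) = g xs + t • act H (x - xs)) :
    ∃ K : ℝ, ∀ᶠ x in 𝓝 xs, ∀ x', SSNStep S N x x' → ‖x' - xs‖ ≤ K * ‖x - xs‖ ^ 2 := by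
  have hmu := hN.mu_pos
  have hmu2 : 0 < 1 / 2 - N.mu := by have := hN.mu_lt; linarith
  have he1 := hN.eta1_pos
  set K := N.eta1 * L ^ 2 / m with hK
  have hK0 : 0 < K := by positivity
  -- The cubic error terms of the Armijo test at unit step add up to `c‖e‖³`; they must stay below
  -- `(1/2 - μ̄) m ‖e‖²`, which fixes the radius of the ball.
  set c := L / 2 * K ^ 2 + N.mu * L * K with hc
  have hc0 : 0 < c := by positivity
  refine ⟨K, ?_⟩
  have hball : ∀ᶠ x in 𝓝 xs, ‖x - xs‖ < min 1 ((1 / 2 - N.mu) * m / c) := by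
    filter_upwards [Metric.ball_mem_nhds xs
      (by positivity : 0 < min 1 ((1 / 2 - N.mu) * m / c))] with x hx
    rwa [mem_ball_iff_norm] at hx
  filter_upwards [hloc, hball] with x hlin hr
  rintro x' ⟨H, hH, d, hd, k, hk, rfl⟩
  have hHS := hS x H hH
  have hlin' : ∀ t ∈ Icc (0 : ℝ) 1, g (xs + t • (x - xs)) = t • act H (x - xs) := fun t ht => by
    rw [hlin H hH t ht, hxs, zero_add]
  have hgx : g x = act H (x - xs) := by
    have := hlin' 1 (right_mem_Icc.2 zero_le_one)
    simpa using this
  have hgrad := (hφ.hasGradientAt hm x).gradient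
  set e := x - xs with he
  have hu : x + d - xs = e + d := by rw [he]; abel
  have hres : ‖act H (e + d)‖ ≤ N.eta1 * L ^ 2 * ‖e‖ ^ 2 := by
    have h1 := hd.2
    rw [hgrad] at h1
    have h2 := hφ.norm_grad_le hm hL hxs x
    rw [act_add, ← hgx, add_comm]
    calc _ ≤ min N.eta0 (N.eta1 * ‖g x‖) * ‖g x‖ := h1
      _ ≤ N.eta1 * ‖g x‖ * ‖g x‖ := by gcongr; exact min_le_right _ _
      _ ≤ N.eta1 * (L * ‖e‖) * (L * ‖e‖) := by gcongr
      _ = _ := by ring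
  -- As `∇φ(x) = H e` exactly, the Newton residual is `H (e + d)`, and `H ≥ m` inverts it.
  have hquad : ‖e + d‖ ≤ K * ‖e‖ ^ 2 := by
    have h1 := (hHS.lower (e + d)).trans (real_inner_le_norm _ _)
    have h2 : m * ‖e + d‖ ≤ ‖act H (e + d)‖ := by
      rcases (norm_nonneg (e + d)).eq_or_lt with h | h
      · rw [← h]; simp
      · refine le_of_mul_le_mul_left ?_ h
        linarith
    have h3 : K * ‖e‖ ^ 2 = N.eta1 * L ^ 2 * ‖e‖ ^ 2 / m := by rw [hK]; ring
    rw [h3, le_div_iff₀ hm]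
    linarith
  have harm : Armijo S N x d 0 := by
    -- With gap `½⟨g, e⟩` at `x` and `⟨g, d⟩ = ⟨g, e + d⟩ - ⟨g, e⟩`, the test leaves a margin `(1/2
    -- - μ̄)⟨g, e⟩`, which dominates the higher-order terms.
    have h1 := hφ.gap_eq_half_inner hm hlin'
    have h2 := hφ.gap_le hxs (x + d)
    rw [hu] at h2
    have h3 := hHS.lower e
    rw [← hHS.symm] at h3
    rw [← hgx] at h1 h3
    have h4 : ⟪g x, d⟫_ℝ = ⟪g x, e + d⟫_ℝ - ⟪g x, e⟫_ℝ := by rw [inner_add_right]; ring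
    have h5 : -(L * ‖e‖ * (K * ‖e‖ ^ 2)) ≤ ⟪g x, e + d⟫_ℝ := by
      refine neg_le_of_abs_le ((abs_real_inner_le_norm _ _).trans ?_)
      have := hφ.norm_grad_le hm hL hxs x
      gcongr
    have h6 : ‖e + d‖ ^ 2 ≤ (K * ‖e‖ ^ 2) ^ 2 := by gcongr
    have hr1 : ‖e‖ ≤ 1 := hr.le.trans (min_le_left _ _)
    have hr2 : c * ‖e‖ ≤ (1 / 2 - N.mu) * m := by
      have := hr.le.trans (min_le_right _ _)
      rw [le_div_iff₀ hc0] at this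
      linarith
    have h7 : L / 2 * ‖e + d‖ ^ 2 ≤ L / 2 * K ^ 2 * ‖e‖ ^ 3 := by
      have h8 : ‖e‖ ^ 4 ≤ ‖e‖ ^ 3 := pow_le_pow_of_le_one (norm_nonneg _) hr1 (by norm_num)
      calc L / 2 * ‖e + d‖ ^ 2 ≤ L / 2 * (K * ‖e‖ ^ 2) ^ 2 := by gcongr
        _ = L / 2 * K ^ 2 * ‖e‖ ^ 4 := by ring
        _ ≤ _ := by gcongr
    have h9 : c * ‖e‖ * ‖e‖ ^ 2 ≤ (1 / 2 - N.mu) * m * ‖e‖ ^ 2 := by gcongr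
    have h10 := mul_le_mul_of_nonneg_left h3 hmu2.le
    have h11 := mul_le_mul_of_nonneg_left h5 hmu.le
    rw [Armijo, hgrad, h4, pow_zero, one_smul]
    rw [hc] at h9
    linarith
  have hk0 : k = 0 := Nat.le_zero.1 (hk.2 harm)
  rw [hk0, pow_zero, one_smul, hu]
  exact hquad

end Method

end RankLasso

theorem mainTheorem6 {n p : ℕ} (hn : 2 ≤ n) (S : RankLasso.Subproblem n p)
    (hlam : 0 < S.lam) (hsig : 0 < S.sig) (hrho : 0 < S.rho)
    (N : RankLasso.SSNParams) (hN : N.Valid) :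
    -- the equation `∇φ = 0` is meaningful and has a unique solution
    Differentiable ℝ S.phi ∧ (∃! xs : RankLasso.Vec p, ∇ S.phi xs = 0) ∧
    -- every step of the method can be carried out, whatever element `H` is selected
    (∀ x : RankLasso.Vec p, (S.genHessian x).Nonempty ∧ ∀ H ∈ S.genHessian x,
      (∃ d, RankLasso.IsNewtonDirection S N x H d) ∧
      ∀ d, RankLasso.IsNewtonDirection S N x H d → ∃ m : ℕ, RankLasso.Armijo S N x d m) ∧
    -- every generated sequence converges quadratically to the solution, and the stopping test
    -- is met after finitely many iterations for every tolerance
    ∀ xs : RankLasso.Vec p, ∇ S.phi xs = 0 →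
      ∀ x : ℕ → RankLasso.Vec p, RankLasso.IsSSNSequence S N x →
        RankLasso.ConvergesQuadratically x xs ∧
        ∀ ε : ℝ, 0 < ε → ∃ i : ℕ, ‖∇ S.phi (x (i + 1))‖ ≤ ε := by
  obtain ⟨a, -, ha⟩ := RankLasso.exists_norm_act_le S.A
  have hm : 0 < 1 / S.sig := by positivity
  have hL : 0 < S.curv a := by unfold RankLasso.Subproblem.curv; positivity
  have hφ := RankLasso.Subproblem.quadBounds_phi hlam hsig hrho ha
  have hS : ∀ x, ∀ H ∈ S.genHessian x, RankLasso.SymmBounds H (1 / S.sig) (S.curv a) :=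
    fun x H hH => RankLasso.Subproblem.symmBounds_of_mem_genHessian hlam hrho ha hH
  have hgrad : ∀ x, ∇ S.phi x = S.grad x := fun x => (hφ.hasGradientAt hm x).gradient
  refine ⟨hφ.differentiable hm, ?_, fun x => ⟨RankLasso.Subproblem.genHessian_nonempty hlam hrho x,
    fun H hH => ⟨RankLasso.exists_isNewtonDirection hN (hS x H hH) hm hL x,
      fun d hd => RankLasso.exists_armijo hφ hm hL hN hd (hS x H hH)⟩⟩, ?_⟩
  · simpa only [hgrad] using hφ.existsUnique_zero hm
  intro xs hxs x hx
  rw [hgrad] at hxs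
  have hlim := RankLasso.tendsto_of_isSSNSequence hφ hm hL hN hS hxs hx
  obtain ⟨K, hK⟩ := RankLasso.eventually_quadratic_step hφ hm hL hN hS hxs
    (RankLasso.Subproblem.eventually_grad_segment hlam hrho xs)
  refine ⟨⟨hlim, K, (hlim.eventually hK).mono fun i hi => hi _ (hx i)⟩, fun ε hε => ?_⟩
  have hnorm : Tendsto (fun i => S.curv a * ‖x (i + 1) - xs‖) atTop (𝓝 0) := by
    simpa using ((tendsto_iff_norm_sub_tendsto_zero.1 hlim).comp
      (tendsto_add_atTop_nat 1)).const_mul (S.curv a)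
  obtain ⟨i, hi⟩ := (hnorm.eventually_lt_const hε).exists
  refine ⟨i, ?_⟩
  rw [hgrad]
  exact (hφ.norm_grad_le hm hL hxs _).trans hi.le
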